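/- All Banach spaces are complex. Let $U,X$ be Banach spaces, let $A:\mathrm{D}(A)\subset X\to X$ generate a strongly continuous semigroup $(T(t))_{t\ge 0}$ on $X$ with growth bound $\omega(T)$, and fix $\beta\in\rho(A)$. Write $R(\alpha,A)=(\alpha I-A)^{-1}$. Let $X_1$ be $\mathrm{D}(A)$ with norm $\|(\beta I-A)x\|$ and $X_{-1}$ the completion of $X$ in the norm $\|R(\beta,A)x\|$. Then $T(t)$, $A$ and $R(\alpha,A)$ extend uniquely to bounded operators $T_{-1}(t):X_{-1}\to X_{-1}$, $A_{-1}:X\to X_{-1}$ and $R(\alpha,A):X_{-1}\to X$. For a Banach space $Y$, a system node $\Sigma(A,B,C,\mathbf G)$ on $(U,X,Y)$ consists of $A$ as above, bounded operators $B:U\to X_{-1}$ and $C:X_1\to Y$, and an analytic function $\mathbf G:\{\operatorname{Re}z>\omega(T)\}\to\mathcal L(U,Y)$ with $\mathbf G(\alpha)-\mathbf G(\gamma)=C[R(\alpha,A)-R(\gamma,A)]B$ for all $\alpha,\gamma$. Its combined operator is $C\&D\,(x,u)=C[x-R(\alpha,A)Bu]+\mathbf G(\alpha)u$ for some (equivalently,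 every) $\alpha$ with $\operatorname{Re}\alpha>\omega(T)$, on the domain $\{(x,u)\in X\times U: A_{-1}x+Bu\in X\}$. A classical solution is a triple $u\in C([0,\infty),U)$, $x\in C^1([0,\infty),X)$, $y\in C([0,\infty),Y)$ such that, for all $t\ge0$, $(x(t),u(t))\in \mathrm D(C\&D)$, $\dot x(t)=A_{-1}x(t)+Bu(t)$ and $y(t)=C\&D\,(x(t),u(t))$. The node is $C^\infty$-BIBO stable if there is $c>0$ such that every classical solution with $u\in C_c^\infty((0,\infty),U)$ and $x(0)=0$ satisfies $y\in L^\infty_{\mathrm{loc}}([0,\infty),Y)$ and $\|y\|_{L^\infty([0,t],Y)}\le c\,\|u\|_{L^\infty([0,t],U)}$ for all $t>0$. The operator $B$ is infinite-time $C$-control-admissible (here $C$ stands for continuous inputs) if there is $c>0$ such that for all $t>0$ and all $u\in C([0,t],U)$ the $X_{-1}$-valued integral $\int_0^tT_{-1}(t-s)Bu(s)\,ds$ belongs to $X$ and $\bigl\|\int_0^tT_{-1}(t-s)Bu(s)\,ds\bigr\|_X\le c\sup_{s\in[0,t]}\|u(s)\|$. **Proposition.** A system node $\Sigma(A,B,I,R(\cdot,A)B)$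 on $(U,X,X)$, i.e. one with $C$ the inclusion $X_1\to X$ and $\mathbf G(\alpha)=R(\alpha,A)B$ for $\operatorname{Re}\alpha>\omega(T)$ (so that its output is its state), is $C^\infty$-BIBO stable if and only if $B$ is infinite-time $C$-control-admissible. -/

import Mathlib

open Set Filter Topology MeasureTheory
open scoped NNReal ENNReal ContDiff

noncomputable section

/-- A strongly continuous semigroup of bounded operators on a complex normed space. -/
structure C0Semigroup (X : Type*) [NormedAddCommGroup X] [NormedSpace ℂ X] where
  toFun : ℝ≥0 → X →L[ℂ] X
  map_zero : toFun 0 = ContinuousLinearMap.id ℂ X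
  map_add : ∀ s t, toFun (s + t) = (toFun s).comp (toFun t)
  continuous_orbit : ∀ x, Continuous fun t => toFun t x

namespace C0Semigroup

instance {X : Type*} [NormedAddCommGroup X] [NormedSpace ℂ X] :
    CoeFun (C0Semigroup X) fun _ => ℝ≥0 → X →L[ℂ] X := ⟨toFun⟩

section Generator

variable {X : Type*} [NormedAddCommGroup X] [NormedSpace ℂ X] (T : C0Semigroup X)

/-- The orbit of `x` has right derivative `y` at time `0`, i.e. `x ∈ D(A)` and `A x = y`. -/
def HasGenerator (x y : X) : Prop :=
  Tendsto (fun t : ℝ≥0 => (t : ℝ)⁻¹ • (T t x - x)) (𝓝[>] 0) (𝓝 y)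

variable {T}

theorem HasGenerator.unique {x y z : X} (h : T.HasGenerator x y) (h' : T.HasGenerator x z) :
    y = z :=
  tendsto_nhds_unique h h'

theorem HasGenerator.add {x y x' y' : X} (h : T.HasGenerator x y) (h' : T.HasGenerator x' y') :
    T.HasGenerator (x + x') (y + y') := by
  refine (Tendsto.add h h').congr fun t => ?_
  rw [← smul_add, _root_.map_add]
  congr 1
  abel

theorem HasGenerator.smul {x y : X} (c : ℂ) (h : T.HasGenerator x y) :
    T.HasGenerator (c • x) (c • y) := by
  refine (Tendsto.const_smul h c).congr fun t => ?_
  rw [smul_comm, map_smul, smul_sub]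

theorem HasGenerator.map {x y : X} (s : ℝ≥0) (h : T.HasGenerator x y) :
    T.HasGenerator (T s x) (T s y) := by
  refine (((T s).continuous.tendsto y).comp h).congr fun t => ?_
  have h1 : T s (T t x) = T t (T s x) := by
    rw [← ContinuousLinearMap.comp_apply, ← ContinuousLinearMap.comp_apply, ← T.map_add,
      ← T.map_add, add_comm]
  simp only [Function.comp_apply]
  rw [ContinuousLinearMap.map_smul_of_tower, map_sub, h1]

variable (T)

/-- The (unbounded) generator `A : D(A) ⊆ X → X` of the semigroup. -/
def generator : X →ₗ.[ℂ] X where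
  domain :=
    { carrier := {x | ∃ y, T.HasGenerator x y}
      add_mem' := fun ⟨y, hy⟩ ⟨z, hz⟩ => ⟨y + z, hy.add hz⟩
      zero_mem' := ⟨0, by simp [HasGenerator]⟩
      smul_mem' := fun c _ ⟨y, hy⟩ => ⟨c • y, hy.smul c⟩ }
  toFun :=
    { toFun := fun x => x.2.choose
      map_add' := fun x y =>
        (x + y).2.choose_spec.unique (x.2.choose_spec.add y.2.choose_spec)
      map_smul' := fun c x => (c • x).2.choose_spec.unique (x.2.choose_spec.smul c) }

theorem generator_spec (x : T.generator.domain) : T.HasGenerator x (T.generator x) :=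
  x.2.choose_spec

theorem HasGenerator.mem {x y : X} (h : T.HasGenerator x y) : x ∈ T.generator.domain := ⟨y, h⟩

/-- `D(A)` is dense in `X`. -/
theorem denseRange_domain [CompleteSpace X] : DenseRange T.generator.domain.subtype := by
  intro x
  set f : ℝ → X := fun s => T s.toNNReal x with hf
  have hfc : Continuous f := (T.continuous_orbit x).comp continuous_real_toNNReal
  have hint : ∀ a b : ℝ, IntervalIntegrable f volume a b := fun a b => hfc.intervalIntegrable a b
  have hder : ∀ a b : ℝ, HasDerivAt (fun r => ∫ s in a..r, f s) (f b) b := fun a b =>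
    intervalIntegral.integral_hasDerivAt_right (hint a b)
      hfc.stronglyMeasurable.stronglyMeasurableAtFilter hfc.continuousAt
  -- the averages of the orbit belong to the domain
  have hmem : ∀ h : ℝ, 0 ≤ h → (∫ s in (0 : ℝ)..h, f s) ∈ T.generator.domain := by
    intro h hh
    refine ⟨f h - f 0, ?_⟩
    have h1 := (hder 0 h).tendsto_slope_zero_right
    have h2 := (hder 0 0).tendsto_slope_zero_right
    have hc : Tendsto (fun t : ℝ≥0 => (t : ℝ)) (𝓝[>] 0) (𝓝[>] 0) := by
      refine tendsto_nhdsWithin_iff.2 ⟨?_, ?_⟩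
      · exact (NNReal.continuous_coe.tendsto' 0 0 rfl).mono_left nhdsWithin_le_nhds
      · filter_upwards [self_mem_nhdsWithin] with t ht
        exact_mod_cast ht
    refine ((h1.sub h2).comp hc).congr fun t => ?_
    simp only [Function.comp_apply, zero_add, intervalIntegral.integral_same, sub_zero]
    rw [← smul_sub]
    congr 1
    have e1 : T t (∫ s in (0 : ℝ)..h, f s) = ∫ s in (t : ℝ)..(h + t), f s := by
      have : ∫ s in (0 : ℝ)..h, f (s + t) = ∫ s in (t : ℝ)..(h + t), f s := by
        simp [intervalIntegral.integral_comp_add_right]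
      rw [← this, ← ContinuousLinearMap.intervalIntegral_comp_comm _ (hint 0 h)]
      refine intervalIntegral.integral_congr fun s hs => ?_
      rw [uIcc_of_le hh] at hs
      simp only [hf]
      have e0 : (s + (t : ℝ)).toNNReal = t + s.toNNReal := by
        rw [Real.toNNReal_add hs.1 t.coe_nonneg, Real.toNNReal_coe, add_comm]
      rw [e0, T.map_add]
      rfl
    rw [e1]
    have a1 := intervalIntegral.integral_add_adjacent_intervals (hint 0 t) (hint t (h + t))
    rw [← a1]
    abel
  have hlim := (hder 0 0).tendsto_slope_zero_right
  simp only [zero_add, intervalIntegral.integral_same, sub_zero] at hlim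
  have hf0 : f 0 = x := by simp [hf, T.map_zero]
  rw [hf0] at hlim
  refine mem_closure_of_tendsto hlim ?_
  filter_upwards [self_mem_nhdsWithin] with t ht
  refine ⟨⟨_, T.generator.domain.smul_mem ((t⁻¹ : ℝ) : ℂ) (hmem t (le_of_lt ht))⟩, ?_⟩
  simp only [Submodule.subtype_apply]
  exact Complex.coe_smul _ _

/-- The operator `α I - A` on `D(A)`. -/
def shifted (α : ℂ) : T.generator.domain →ₗ[ℂ] X :=
  α • T.generator.domain.subtype - T.generator.toFun

/-- `R` is a bounded inverse of `α I - A`. -/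
def IsResolvent (α : ℂ) (R : X →L[ℂ] X) : Prop :=
  (∀ x, ∃ h : R x ∈ T.generator.domain, T.shifted α ⟨R x, h⟩ = x) ∧
    ∀ x : T.generator.domain, R (T.shifted α x) = x

/-- The resolvent set `ρ(A)`. -/
def resolventSet : Set ℂ := {α | ∃ R, T.IsResolvent α R}

open scoped Classical in
/-- The resolvent `R(α, A) = (α I - A)⁻¹` for `α ∈ ρ(A)` (and `0` otherwise). -/
def resolvent (α : ℂ) : X →L[ℂ] X :=
  if h : α ∈ T.resolventSet then h.choose else 0

theorem isResolvent {α : ℂ} (h : α ∈ T.resolventSet) : T.IsResolvent α (T.resolvent α) := by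
  rw [resolvent, dif_pos h]
  exact h.choose_spec

theorem shifted_injective {α : ℂ} (h : α ∈ T.resolventSet) :
    Function.Injective (T.shifted α) := fun x y hxy => by
  have := congrArg (T.resolvent α) hxy
  rw [(T.isResolvent h).2, (T.isResolvent h).2] at this
  exact Subtype.ext this

/-- The growth bound `ω(T) ∈ [-∞, ∞)`: the infimum of the exponential rates that bound `T`. -/
def growthBound : EReal :=
  sInf {w | ∃ r : ℝ, w = r ∧ ∃ M : ℝ, ∀ t : ℝ≥0, ‖T t‖ ≤ M * Real.exp (r * t)}

/-- The open right half-plane `{z | Re z > ω(T)}`. -/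
def halfPlane : Set ℂ := {z | T.growthBound < (z.re : EReal)}

end Generator

section Spaces

variable {X : Type*} [NormedAddCommGroup X] [NormedSpace ℂ X] (T : C0Semigroup X)
  (β : T.resolventSet)

/-- The space `X₁`: `D(A)` with the norm `‖(β I - A) x‖`. -/
def X1 (_ : T.resolventSet) : Type _ := T.generator.domain

instance : AddCommGroup (T.X1 β) := inferInstanceAs (AddCommGroup T.generator.domain)
instance : Module ℂ (T.X1 β) := inferInstanceAs (Module ℂ T.generator.domain)

/-- `β I - A` as a map on `X₁`. -/
def X1.shift : T.X1 β →ₗ[ℂ] X := T.shifted β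

instance : NormedAddCommGroup (T.X1 β) :=
  NormedAddCommGroup.induced _ _ (X1.shift T β) (T.shifted_injective β.2)

instance : NormedSpace ℂ (T.X1 β) := NormedSpace.induced ℂ _ _ (X1.shift T β)

/-- The inclusion `X₁ → X`. -/
def X1.incl : T.X1 β →L[ℂ] X :=
  LinearMap.mkContinuous T.generator.domain.subtype ‖T.resolvent β‖ fun x => by
    have h := (T.isResolvent β.2).2 x
    calc ‖T.generator.domain.subtype x‖ = ‖T.resolvent β (T.shifted β x)‖ := by rw [h]; rfl
      _ ≤ ‖T.resolvent β‖ * ‖T.shifted β x‖ := (T.resolvent β).le_opNorm _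

/-- `X` with the norm `‖R(β, A) x‖`. -/
def PreXm1 (_ : T.resolventSet) : Type _ := X

instance : AddCommGroup (T.PreXm1 β) := inferInstanceAs (AddCommGroup X)
instance : Module ℂ (T.PreXm1 β) := inferInstanceAs (Module ℂ X)

/-- `R(β, A)` as a map on `X` with the weaker norm. -/
def PreXm1.res : T.PreXm1 β →ₗ[ℂ] X := (T.resolvent β).toLinearMap

theorem PreXm1.res_injective : Function.Injective (PreXm1.res T β) := fun x y hxy => by
  obtain ⟨h1, e1⟩ := (T.isResolvent β.2).1 x
  obtain ⟨h2, e2⟩ := (T.isResolvent β.2).1 y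
  have : (⟨_, h1⟩ : T.generator.domain) = ⟨_, h2⟩ := Subtype.ext hxy
  exact e1.symm.trans ((congrArg (T.shifted β) this).trans e2)

instance : NormedAddCommGroup (T.PreXm1 β) :=
  NormedAddCommGroup.induced _ _ (PreXm1.res T β) (PreXm1.res_injective T β)

instance : NormedSpace ℂ (T.PreXm1 β) := NormedSpace.induced ℂ _ _ (PreXm1.res T β)

/-- The extrapolation space `X₋₁`: the completion of `X` in the norm `‖R(β, A) x‖`. -/
def Xm1 : Type _ := UniformSpace.Completion (T.PreXm1 β)

instance : NormedAddCommGroup (T.Xm1 β) :=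
  inferInstanceAs (NormedAddCommGroup (UniformSpace.Completion (T.PreXm1 β)))
instance : NormedSpace ℂ (T.Xm1 β) :=
  inferInstanceAs (NormedSpace ℂ (UniformSpace.Completion (T.PreXm1 β)))
instance : CompleteSpace (T.Xm1 β) :=
  inferInstanceAs (CompleteSpace (UniformSpace.Completion (T.PreXm1 β)))

/-- The embedding `X → X₋₁` as a linear map. -/
def toXm1 : X →ₗ[ℂ] T.Xm1 β where
  toFun x := ((show T.PreXm1 β from x : T.PreXm1 β) : UniformSpace.Completion (T.PreXm1 β))
  map_add' x y := UniformSpace.Completion.coe_add (α := T.PreXm1 β) x y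
  map_smul' c x := UniformSpace.Completion.coe_smul (M := ℂ) (X := T.PreXm1 β) c x

theorem norm_toXm1 (x : X) : ‖T.toXm1 β x‖ = ‖T.resolvent β x‖ :=
  UniformSpace.Completion.norm_coe (E := T.PreXm1 β) x

theorem denseRange_toXm1 : DenseRange (T.toXm1 β) :=
  UniformSpace.Completion.denseRange_coe (α := T.PreXm1 β)

theorem toXm1_injective : Function.Injective (T.toXm1 β) := by
  refine (injective_iff_map_eq_zero _).2 fun x hx => ?_
  have h : ‖T.resolvent β x‖ = 0 := by rw [← norm_toXm1, hx, norm_zero]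
  exact PreXm1.res_injective T β ((norm_eq_zero.1 h).trans (_root_.map_zero (T.resolvent β)).symm)

/-- The unique bounded extension `T₋₁(t)` of `T(t)` to `X₋₁`. -/
def extSemigroup (t : ℝ≥0) : T.Xm1 β →L[ℂ] T.Xm1 β :=
  (T.toXm1 β ∘ₗ (T t).toLinearMap).extendOfNorm (T.toXm1 β)

/-- The unique bounded extension `X₋₁ → X` of the resolvent `R(α, A)`. -/
def extResolvent [CompleteSpace X] (α : ℂ) : T.Xm1 β →L[ℂ] X :=
  (T.resolvent α).toLinearMap.extendOfNorm (T.toXm1 β)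

/-- The unique bounded extension `X → X₋₁` of the generator `A`. -/
def extGenerator : X →L[ℂ] T.Xm1 β :=
  (T.toXm1 β ∘ₗ T.generator.toFun).extendOfNorm T.generator.domain.subtype

theorem resolvent_comm {α : ℂ} (hα : α ∈ T.resolventSet) (t : ℝ≥0) (x : X) :
    T.resolvent α (T t x) = T t (T.resolvent α x) := by
  obtain ⟨h, e⟩ := (T.isResolvent hα).1 x
  have hg := (T.generator_spec ⟨_, h⟩).map t
  have e' : T.shifted α ⟨_, hg.mem⟩ = T t x := by
    conv_rhs => rw [← e]
    have := (T.generator_spec ⟨_, hg.mem⟩).unique hg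
    change α • T t (T.resolvent α x) - T.generator ⟨_, hg.mem⟩
      = T t (α • T.resolvent α x - T.generator ⟨_, h⟩)
    rw [this, map_sub, map_smul]
  rw [← e', (T.isResolvent hα).2]

theorem resolvent_identity {α γ : ℂ} (hα : α ∈ T.resolventSet) (hγ : γ ∈ T.resolventSet) (x : X) :
    T.resolvent α x = T.resolvent γ x + (γ - α) • T.resolvent α (T.resolvent γ x) := by
  obtain ⟨h, e⟩ := (T.isResolvent hγ).1 x
  have e2 : T.shifted α ⟨_, h⟩ = x - (γ - α) • T.resolvent γ x := by
    conv_rhs => rw [← e]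
    rw [e]
    have e0 : γ • T.resolvent γ x - T.generator ⟨_, h⟩ = x := e
    change α • T.resolvent γ x - T.generator ⟨_, h⟩ = x - (γ - α) • T.resolvent γ x
    nth_rewrite 3 [← e0]
    module
  have e3 := (T.isResolvent hα).2 ⟨_, h⟩
  rw [e2, map_sub, map_smul] at e3
  exact eq_add_of_sub_eq e3

/-- `T₋₁(t)` extends `T(t)`. -/
theorem extSemigroup_toXm1 (t : ℝ≥0) (x : X) :
    T.extSemigroup β t (T.toXm1 β x) = T.toXm1 β (T t x) :=
  LinearMap.extendOfNorm_eq (T.denseRange_toXm1 β) ⟨‖T t‖, fun x => by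
    simp only [LinearMap.comp_apply, ContinuousLinearMap.coe_coe, norm_toXm1]
    rw [T.resolvent_comm β.2]
    exact (T t).le_opNorm _⟩ x

/-- The extended resolvent extends `R(α, A)`. -/
theorem extResolvent_toXm1 [CompleteSpace X] {α : ℂ} (hα : α ∈ T.resolventSet) (x : X) :
    T.extResolvent β α (T.toXm1 β x) = T.resolvent α x :=
  LinearMap.extendOfNorm_eq (f := (T.resolvent α).toLinearMap) (T.denseRange_toXm1 β) ⟨1 + ‖((β : ℂ) - α) • T.resolvent α‖,
    fun x => by
      simp only [ContinuousLinearMap.coe_coe, norm_toXm1]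
      rw [T.resolvent_identity hα β.2 x, add_mul, one_mul]
      refine (norm_add_le _ _).trans
        (add_le_add le_rfl ((((β : ℂ) - α) • T.resolvent α).le_opNorm _))⟩ x

/-- The extended generator extends `A`. -/
theorem extGenerator_coe [CompleteSpace X] (x : T.generator.domain) :
    T.extGenerator β x = T.toXm1 β (T.generator x) :=
  LinearMap.extendOfNorm_eq (f := T.toXm1 β ∘ₗ T.generator.toFun)
    (e := T.generator.domain.subtype) T.denseRange_domain
    ⟨‖(β : ℂ) • T.resolvent β - ContinuousLinearMap.id ℂ X‖, fun x => by
      have h : T.resolvent β (T.generator x)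
          = ((β : ℂ) • T.resolvent β - ContinuousLinearMap.id ℂ X) (x : X) := by
        have e := (T.isResolvent β.2).2 x
        change T.resolvent β ((β : ℂ) • (x : X) - T.generator x) = x at e
        rw [map_sub, map_smul] at e
        simp only [sub_apply, smul_apply, ContinuousLinearMap.id_apply]
        nth_rewrite 2 [← e]
        abel
      change ‖T.toXm1 β (T.generator x)‖ ≤ _ * ‖(x : X)‖
      rw [norm_toXm1, h]
      exact ContinuousLinearMap.le_opNorm _ _⟩ x

end Spaces

end C0Semigroup

/-- A system node `Σ(A, B, C, G)` on `(U, X, Y)`, where `A` is the generator of `T`, and `X₁`, `X₋₁`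
are formed with `β ∈ ρ(A)`. The values of `G` off the half-plane `Re z > ω(T)` carry no
information. -/
structure SystemNode (U X Y : Type*) [NormedAddCommGroup U] [NormedSpace ℂ U]
    [NormedAddCommGroup X] [NormedSpace ℂ X] [CompleteSpace X]
    [NormedAddCommGroup Y] [NormedSpace ℂ Y] where
  T : C0Semigroup X
  β : T.resolventSet
  B : U →L[ℂ] T.Xm1 β
  C : T.X1 β →L[ℂ] Y
  G : ℂ → U →L[ℂ] Y
  analytic : AnalyticOnNhd ℂ G T.halfPlane
  /-- `G(α) - G(γ) = C [R(α, A) - R(γ, A)] B`, where the bracket maps into `D(A)`. -/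
  transfer : ∀ α ∈ T.halfPlane, ∀ γ ∈ T.halfPlane, ∀ u : U,
    ∃ z : T.X1 β, C0Semigroup.X1.incl T β z
        = T.extResolvent β α (B u) - T.extResolvent β γ (B u) ∧
      G α u - G γ u = C z

namespace SystemNode

variable {U X Y : Type*} [NormedAddCommGroup U] [NormedSpace ℂ U]
    [NormedAddCommGroup X] [NormedSpace ℂ X] [CompleteSpace X]
    [NormedAddCommGroup Y] [NormedSpace ℂ Y]

/-- The domain `{(x, u) | A x + B u ∈ X}` of the combined observation/feedthrough operator. -/
def domCD (S : SystemNode U X Y) : Set (X × U) :=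
  {p | S.T.extGenerator S.β p.1 + S.B p.2 ∈ range (S.T.toXm1 S.β)}

/-- `y = C&D (x, u)`, i.e. `(x, u) ∈ D(C&D)` and
`y = C [x - R(α, A) B u] + G(α) u` for some `α` with `Re α > ω(T)`. -/
def IsCD (S : SystemNode U X Y) (x : X) (u : U) (y : Y) : Prop :=
  (x, u) ∈ S.domCD ∧ ∃ α ∈ S.T.halfPlane, ∃ z : S.T.X1 S.β,
    C0Semigroup.X1.incl S.T S.β z = x - S.T.extResolvent S.β α (S.B u) ∧
      y = S.C z + S.G α u

/-- Classical solutions on `[0, ∞)`: only the values at times `t ≥ 0` matter, and the derivative at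
`t = 0` is one-sided. -/
structure IsClassicalSolution (S : SystemNode U X Y) (u : ℝ → U) (x : ℝ → X) (y : ℝ → Y) :
    Prop where
  continuousOn_input : ContinuousOn u (Ici 0)
  contDiffOn_state : ContDiffOn ℝ 1 x (Ici 0)
  continuousOn_output : ContinuousOn y (Ici 0)
  state_eq : ∀ t ∈ Ici (0 : ℝ), S.T.toXm1 S.β (derivWithin x (Ici 0) t)
    = S.T.extGenerator S.β (x t) + S.B (u t)
  output_eq : ∀ t ∈ Ici (0 : ℝ), S.IsCD (x t) (u t) (y t)

/-- `C^∞`-BIBO stability. -/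
def IsSmoothBIBOStable (S : SystemNode U X Y) : Prop :=
  ∃ c : ℝ, 0 < c ∧ ∀ (u : ℝ → U) (x : ℝ → X) (y : ℝ → Y),
    ContDiff ℝ ∞ u → HasCompactSupport u → tsupport u ⊆ Ioi 0 →
    S.IsClassicalSolution u x y → x 0 = 0 →
    ∀ t : ℝ, 0 < t → MemLp y ∞ (volume.restrict (Icc 0 t)) ∧
      eLpNorm y ∞ (volume.restrict (Icc 0 t))
        ≤ ENNReal.ofReal c * eLpNorm u ∞ (volume.restrict (Icc 0 t))

/-- The output is the state: the node is `Σ(A, B, I, R(·, A) B)`. -/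
def OutputIsState (S : SystemNode U X X) : Prop :=
  S.C = C0Semigroup.X1.incl S.T S.β ∧
    ∀ α ∈ S.T.halfPlane, S.G α = (S.T.extResolvent S.β α).comp S.B

end SystemNode

/-- `B ∈ L(U, X₋₁)` is infinite-time `C`-control-admissible: for all `t > 0` and continuous
`u : [0, t] → U` the `X₋₁`-valued integral `∫₀ᵗ T₋₁(t - s) B u(s) ds` lies in `X`, with `X`-norm at
most `c ‖u‖_∞`, where `c` does not depend on `t`. -/
def C0Semigroup.InfiniteTimeCControlAdmissible {U X : Type*} [NormedAddCommGroup U]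
    [NormedSpace ℂ U] [NormedAddCommGroup X] [NormedSpace ℂ X] (T : C0Semigroup X)
    (β : T.resolventSet) (B : U →L[ℂ] T.Xm1 β) : Prop :=
  ∃ c : ℝ, 0 < c ∧ ∀ t : ℝ, 0 < t → ∀ u : ℝ → U, ContinuousOn u (Icc 0 t) →
    ∃ z : X, T.toXm1 β z = ∫ s in (0 : ℝ)..t, T.extSemigroup β (t - s).toNNReal (B (u s)) ∧
      ‖z‖ ≤ c * ⨆ s : Icc (0 : ℝ) t, ‖u s‖

end

/-! The extended resolvent `R(β, A)` maps `X₋₁` isometrically into `X` and commutes with the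
semigroup. It turns the statement that `z` is the state reached at time `t` into R(β,A)z = ∫₀ᵗ
T(t-s) R(β,A)B u(s) ds, an identity in `X` with the bounded operator R(β,A)B
(`toXm1_eq_integral_iff`).

As output and state coincide, stability bounds the states reached by smooth inputs, while
admissibility bounds those reached by continuous inputs. Admissibility implies stability because
classical solutions obey variation of constants (`resolvent_state`) and R(β,A) is injective.

For the converse, a smooth input supported in (0,∞) has an explicit classical solution. Its state at
time `t` is thus bounded by the input, and density with a Cauchy argument covers every continuous
`u` with u(0) = 0 (`reaches_of_eq_zero`). If u(0) ≠ 0, uniform approximation fails. A ramp run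
before `u` still shows that the reached state lies in `X`. Its bound comes from the cut-offs
min(ns,1)u, which converge pointwise on (0,t]: their states are bounded and converge in `X₋₁`, and
such a limit is bounded up to a factor depending only on T on [0,1]
(`exists_norm_le_of_tendsto_resolvent`). Hence the constant is uniform in `t`. -/

noncomputable section

namespace C0Semigroup

/-! ### Joint continuity, the product rule and the variation of constants integral. -/

section Semigroup

variable {X : Type*} [NormedAddCommGroup X] [NormedSpace ℂ X] (T : C0Semigroup X)

theorem map_add_apply (s t : ℝ≥0) (x : X) : T (s + t) x = T s (T t x) := by
  rw [T.map_add]; rfl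

theorem map_zero_apply (x : X) : T 0 x = x := by
  rw [T.map_zero]; rfl

/-- A strongly continuous semigroup is bounded on bounded time intervals. -/
theorem exists_norm_le [CompleteSpace X] (a : ℝ≥0) :
    ∃ M : ℝ, 1 ≤ M ∧ ∀ t ≤ a, ‖T t‖ ≤ M := by
  obtain ⟨M, hM⟩ := banach_steinhaus (g := fun t : Icc (0 : ℝ≥0) a => T t) fun x => by
    obtain ⟨C, hC⟩ := (isCompact_Icc (a := (0 : ℝ≥0)) (b := a)).exists_bound_of_continuousOn
      (T.continuous_orbit x).continuousOn
    exact ⟨C, fun t => hC t t.2⟩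
  exact ⟨max 1 M, le_max_left _ _, fun t ht => (hM ⟨t, zero_le, ht⟩).trans (le_max_right _ _)⟩

/-- Joint continuity of `(t, x) ↦ T(t) x`. -/
theorem continuous_uncurry [CompleteSpace X] :
    Continuous fun p : ℝ × X => T p.1.toNNReal p.2 := by
  refine continuous_iff_continuousAt.2 fun p => ?_
  obtain ⟨M, hM1, hM⟩ := T.exists_norm_le (p.1 + 1).toNNReal
  -- Negative times are clamped to 0, so one Lipschitz constant `M` in `x` serves all times below
  -- p.1 + 1.
  have h : ContinuousOn (fun p : ℝ × X => T p.1.toNNReal p.2) (Iio (p.1 + 1) ×ˢ univ) := by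
    refine continuousOn_prod_of_continuousOn_lipschitzOnWith' _ M.toNNReal ?_ ?_
    · intro t ht
      refine (LipschitzWith.weaken (T t.toNNReal).lipschitz ?_).lipschitzOnWith
      rw [← NNReal.coe_le_coe, Real.coe_toNNReal _ (by linarith)]
      exact hM _ (Real.toNNReal_le_toNNReal (le_of_lt ht))
    · intro x _
      exact ((T.continuous_orbit x).comp continuous_real_toNNReal).continuousOn
  exact h.continuousAt ((isOpen_Iio.prod isOpen_univ).mem_nhds ⟨by simp, trivial⟩)

variable {T}

theorem HasGenerator.tendsto_real {x y : X} (h : T.HasGenerator x y) :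
    Tendsto (fun t : ℝ => t⁻¹ • (T t.toNNReal x - x)) (𝓝[>] 0) (𝓝 y) := by
  have hc : Tendsto Real.toNNReal (𝓝[>] 0) (𝓝[>] 0) := by
    refine tendsto_nhdsWithin_iff.2 ⟨?_, ?_⟩
    · exact (continuous_real_toNNReal.tendsto' 0 0 (by simp)).mono_left nhdsWithin_le_nhds
    · filter_upwards [self_mem_nhdsWithin] with t ht
      simpa using ht
  refine (h.comp hc).congr' ?_
  filter_upwards [self_mem_nhdsWithin] with t ht
  simp only [Function.comp_apply, Real.coe_toNNReal _ (le_of_lt ht)]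

theorem hasGenerator_of_hasDerivAt {x y : X} {f : ℝ → X} (hf : HasDerivAt f y 0)
    (h : ∀ t : ℝ≥0, f t = T t x) : T.HasGenerator x y := by
  have h1 := hf.tendsto_slope_zero_right
  have hc : Tendsto (fun t : ℝ≥0 => (t : ℝ)) (𝓝[>] 0) (𝓝[>] 0) := by
    refine tendsto_nhdsWithin_iff.2 ⟨?_, ?_⟩
    · exact (NNReal.continuous_coe.tendsto' 0 0 rfl).mono_left nhdsWithin_le_nhds
    · filter_upwards [self_mem_nhdsWithin] with t ht
      exact_mod_cast ht
  refine (h1.comp hc).congr fun t => ?_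
  have h0 := h 0
  simp only [NNReal.coe_zero, T.map_zero_apply] at h0
  simp only [Function.comp_apply, zero_add, h, h0]

/-- Product rule for `s ↦ T(t - s) h(s)`. -/
theorem HasGenerator.hasDerivWithinAt [CompleteSpace X] {h : ℝ → X} {s t : ℝ} {y h' : X}
    (hst : s < t) (hy : T.HasGenerator (h s) y) (hh : HasDerivWithinAt h h' (Ioi s) s) :
    HasDerivWithinAt (fun r => T (t - r).toNNReal (h r)) (T (t - s).toNNReal (h' - y))
      (Ioi s) s := by
  rw [hasDerivWithinAt_iff_tendsto_slope' self_notMem_Ioi] at hh ⊢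
  have h1 : Tendsto (fun r : ℝ => r - s) (𝓝[>] s) (𝓝[>] 0) := by
    refine tendsto_nhdsWithin_iff.2 ⟨?_, ?_⟩
    · exact ((continuous_id.sub continuous_const).tendsto' s 0 (by simp)).mono_left
        nhdsWithin_le_nhds
    · filter_upwards [self_mem_nhdsWithin] with r hr
      simpa using hr
  -- Since T(t-s) = T(t-r)T(r-s), the slope is T(t-r) applied to the slope of `h` minus the
  -- generator quotient of h(s); joint continuity gives the limit.
  have h2 := hh.sub (hy.tendsto_real.comp h1)
  have h3 : Tendsto (fun r : ℝ => t - r) (𝓝[>] s) (𝓝 (t - s)) :=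
    ((continuous_const.sub continuous_id).tendsto s).mono_left nhdsWithin_le_nhds
  refine ((T.continuous_uncurry.tendsto (t - s, h' - y)).comp (h3.prodMk_nhds h2)).congr' ?_
  filter_upwards [Ioo_mem_nhdsGT hst] with r hr
  have e : (t - s).toNNReal = (t - r).toNNReal + (r - s).toNNReal := by
    rw [← Real.toNNReal_add (by linarith [hr.2]) (by linarith [hr.1])]
    congr 1
    ring
  simp only [Function.comp_apply, slope, vsub_eq_sub, e, T.map_add_apply]
  rw [← smul_sub, ContinuousLinearMap.map_smul_of_tower, ← map_sub]
  congr 2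
  abel

variable (T)

/-- The variation of constants integral `∫₀ᵗ T(t - s) g(s) ds`. -/
def duhamel (g : ℝ → X) (t : ℝ) : X := ∫ s in (0 : ℝ)..t, T (t - s).toNNReal (g s)

theorem continuousOn_duhamel_integrand [CompleteSpace X] {g : ℝ → X} {K : Set ℝ} (t : ℝ)
    (hg : ContinuousOn g K) : ContinuousOn (fun s => T (t - s).toNNReal (g s)) K :=
  T.continuous_uncurry.comp_continuousOn
    ((continuousOn_const.sub continuousOn_id).prodMk hg)

theorem intervalIntegrable_duhamel [CompleteSpace X] {g : ℝ → X} {t : ℝ} (ht : 0 ≤ t)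
    (hg : ContinuousOn g (Icc 0 t)) :
    IntervalIntegrable (fun s => T (t - s).toNNReal (g s)) volume 0 t :=
  (T.continuousOn_duhamel_integrand t (by rwa [uIcc_of_le ht])).intervalIntegrable

theorem duhamel_congr {g g' : ℝ → X} {t : ℝ} (ht : 0 ≤ t) (h : EqOn g g' (Icc 0 t)) :
    T.duhamel g t = T.duhamel g' t := by
  refine intervalIntegral.integral_congr fun s hs => ?_
  rw [uIcc_of_le ht] at hs
  simp only [h hs]

theorem duhamel_add [CompleteSpace X] {g g' : ℝ → X} {t : ℝ} (ht : 0 ≤ t)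
    (hg : ContinuousOn g (Icc 0 t)) (hg' : ContinuousOn g' (Icc 0 t)) :
    T.duhamel (fun s => g s + g' s) t = T.duhamel g t + T.duhamel g' t := by
  simp only [duhamel, _root_.map_add]
  exact intervalIntegral.integral_add (T.intervalIntegrable_duhamel ht hg)
    (T.intervalIntegrable_duhamel ht hg')

theorem duhamel_sub [CompleteSpace X] {g g' : ℝ → X} {t : ℝ} (ht : 0 ≤ t)
    (hg : ContinuousOn g (Icc 0 t)) (hg' : ContinuousOn g' (Icc 0 t)) :
    T.duhamel (fun s => g s - g' s) t = T.duhamel g t - T.duhamel g' t := by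
  simp only [duhamel, _root_.map_sub]
  exact intervalIntegral.integral_sub (T.intervalIntegrable_duhamel ht hg)
    (T.intervalIntegrable_duhamel ht hg')

theorem duhamel_smul (c : ℂ) (g : ℝ → X) (t : ℝ) :
    T.duhamel (fun s => c • g s) t = c • T.duhamel g t := by
  simp only [duhamel, map_smul]
  exact intervalIntegral.integral_smul _ _

/-- A bounded operator that commutes with the semigroup commutes with the integral. -/
theorem map_duhamel [CompleteSpace X] (L : X →L[ℂ] X) (hL : ∀ t x, L (T t x) = T t (L x))
    {g : ℝ → X} {t : ℝ} (ht : 0 ≤ t) (hg : ContinuousOn g (Icc 0 t)) :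
    L (T.duhamel g t) = T.duhamel (fun s => L (g s)) t := by
  rw [duhamel, ← ContinuousLinearMap.intervalIntegral_comp_comm _
    (T.intervalIntegrable_duhamel ht hg)]
  simp only [hL, duhamel]

/-- The fundamental theorem of calculus for `s ↦ T(t - s) h(s)`. -/
theorem duhamel_eq_sub [CompleteSpace X] {h h' a : ℝ → X} {t : ℝ} (ht : 0 ≤ t)
    (hc : ContinuousOn h (Icc 0 t)) (hc' : ContinuousOn h' (Icc 0 t))
    (hca : ContinuousOn a (Icc 0 t)) (ha : ∀ s ∈ Ioo 0 t, T.HasGenerator (h s) (a s))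
    (hd : ∀ s ∈ Ioo 0 t, HasDerivWithinAt h (h' s) (Ioi s) s) :
    T.duhamel (fun s => h' s - a s) t = h t - T t.toNNReal (h 0) := by
  have key := intervalIntegral.integral_eq_sub_of_hasDeriv_right
    (f := fun r => T (t - r).toNNReal (h r))
    (f' := fun s => T (t - s).toNNReal (h' s - a s)) (a := 0) (b := t)
    (T.continuousOn_duhamel_integrand t (by rwa [uIcc_of_le ht]))
    (fun s hs => by
      rw [min_eq_left ht, max_eq_right ht] at hs
      exact (ha s hs).hasDerivWithinAt hs.2 (hd s hs))
    (T.intervalIntegrable_duhamel ht (hc'.sub hca))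
  simpa [duhamel, T.map_zero_apply] using key

theorem hasGenerator_resolvent {α : ℂ} (hα : α ∈ T.resolventSet) (x : X) :
    T.HasGenerator (T.resolvent α x) (α • T.resolvent α x - x) := by
  obtain ⟨h, e⟩ := (T.isResolvent hα).1 x
  have e0 : α • T.resolvent α x - T.generator ⟨_, h⟩ = x := e
  have := T.generator_spec ⟨_, h⟩
  rw [show T.generator ⟨_, h⟩ = α • T.resolvent α x - x by nth_rewrite 3 [← e0]; abel] at this
  exact this

theorem resolvent_injective {α : ℂ} (hα : α ∈ T.resolventSet) :
    Function.Injective (T.resolvent α) := fun x y hxy => by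
  have h1 := T.hasGenerator_resolvent hα x
  rw [hxy] at h1
  simpa using h1.unique (T.hasGenerator_resolvent hα y)

theorem HasGenerator.resolvent_sub {T : C0Semigroup X} {α : ℂ} (hα : α ∈ T.resolventSet) {x y : X}
    (h : T.HasGenerator x y) : T.resolvent α (α • x - y) = x := by
  have h1 := (T.isResolvent hα).2 ⟨x, h.mem⟩
  rwa [show T.shifted α ⟨x, h.mem⟩ = α • x - y from
    congrArg (α • x - ·) ((T.generator_spec ⟨x, h.mem⟩).unique h)] at h1

end Semigroup

/-! ### Resolvent points in the half-plane Re z > ω(T). -/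

section Resolvent

variable {X : Type*} [NormedAddCommGroup X] [NormedSpace ℂ X]

theorem continuous_exp_smul (α : ℂ) (x : X) : Continuous fun s : ℝ => Complex.exp (α * s) • x :=
  by fun_prop

theorem hasDerivAt_exp_smul (α : ℂ) (x : X) (s : ℝ) :
    HasDerivAt (fun s : ℝ => Complex.exp (α * s) • x) (Complex.exp (α * s) • (α • x)) s := by
  have h : HasDerivAt (fun s : ℝ => Complex.exp (α * s)) (Complex.exp (α * s) * (α * 1)) s :=
    ((Complex.ofRealCLM.hasDerivAt (x := s)).const_mul α).cexp
  simpa [mul_smul] using h.smul_const x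

variable [CompleteSpace X] (T : C0Semigroup X)

/-- The bounded operator `x ↦ ∫₀¹ e^{α s} T(1 - s) x ds`. -/
def truncatedLaplace (α : ℂ) : X →L[ℂ] X :=
  LinearMap.mkContinuousOfExistsBound
    { toFun := fun x => T.duhamel (fun s => Complex.exp (α * s) • x) 1
      map_add' := fun x y => by
        simp only [smul_add]
        exact T.duhamel_add zero_le_one (continuous_exp_smul α x).continuousOn
          (continuous_exp_smul α y).continuousOn
      map_smul' := fun c x => by
        simp only [smul_comm _ c x]
        exact T.duhamel_smul _ _ _ } <| by
    obtain ⟨M, hM1, hM⟩ := T.exists_norm_le 1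
    obtain ⟨C, hC⟩ := (isCompact_Icc (a := (0 : ℝ)) (b := 1)).exists_bound_of_continuousOn
      (f := fun s : ℝ => Complex.exp (α * s)) (by fun_prop)
    refine ⟨M * C, fun x => ?_⟩
    refine (intervalIntegral.norm_integral_le_of_norm_le_const (C := M * C * ‖x‖)
      fun s hs => ?_).trans (by simp)
    rw [uIoc_of_le zero_le_one] at hs
    have h1 : (1 - s).toNNReal ≤ 1 := by simpa using hs.1.le
    calc _ ≤ ‖T (1 - s).toNNReal‖ * ‖Complex.exp (α * s) • x‖ := ContinuousLinearMap.le_opNorm _ _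
      _ = ‖T (1 - s).toNNReal‖ * ‖Complex.exp (α * s)‖ * ‖x‖ := by rw [norm_smul, mul_assoc]
      _ ≤ M * C * ‖x‖ := by
        have := hC s ⟨hs.1.le, hs.2⟩
        have := hM _ h1
        gcongr

theorem truncatedLaplace_apply (α : ℂ) (x : X) :
    T.truncatedLaplace α x = T.duhamel (fun s => Complex.exp (α * s) • x) 1 := rfl

/-- Fundamental theorem of calculus for e^{αs} T(1-s)x, with derivative e^{αs} T(1-s)(αx - Ax). -/
theorem HasGenerator.truncatedLaplace {T : C0Semigroup X} (α : ℂ) {x y : X}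
    (h : T.HasGenerator x y) :
    T.truncatedLaplace α (α • x - y) = Complex.exp α • x - T 1 x := by
  have := T.duhamel_eq_sub (h := fun s : ℝ => Complex.exp (α * s) • x)
    (h' := fun s : ℝ => Complex.exp (α * s) • (α • x))
    (a := fun s : ℝ => Complex.exp (α * s) • y) zero_le_one
    (continuous_exp_smul α x).continuousOn (continuous_exp_smul α _).continuousOn
    (continuous_exp_smul α y).continuousOn (fun s _ => h.smul _)
    (fun s _ => (hasDerivAt_exp_smul α x s).hasDerivWithinAt)
  simpa [truncatedLaplace_apply, smul_sub] using this

/-- Applying T(t) shifts the window of integration from [0,1] to [-t,1-t] and multiplies by e^{αt}.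
Differentiating at t = 0 gives the α term and the two endpoint terms. -/
theorem hasGenerator_truncatedLaplace (α : ℂ) (x : X) :
    T.HasGenerator (T.truncatedLaplace α x)
      (α • T.truncatedLaplace α x - (Complex.exp α • x - T 1 x)) := by
  set f : ℝ → X := fun s => Complex.exp (α * s) • T (1 - s).toNNReal x with hf
  have hfc : Continuous f := by
    have := T.continuous_uncurry.comp
      (show Continuous fun s : ℝ => ((1 - s, x) : ℝ × X) by fun_prop)
    simp only [Function.comp_def] at this
    fun_prop
  have hint : ∀ a b : ℝ, IntervalIntegrable f volume a b := fun a b => hfc.intervalIntegrable a b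
  have hder : ∀ b : ℝ, HasDerivAt (fun r => ∫ s in (0 : ℝ)..r, f s) (f b) b := fun b =>
    intervalIntegral.integral_hasDerivAt_right (hint 0 b)
      hfc.stronglyMeasurable.stronglyMeasurableAtFilter hfc.continuousAt
  have hI : ∀ t : ℝ, 0 ≤ t → T t.toNNReal (T.truncatedLaplace α x)
      = Complex.exp (α * t) • ((∫ s in (0 : ℝ)..(1 - t), f s) - ∫ s in (0 : ℝ)..(-t), f s) := by
    intro t ht
    rw [intervalIntegral.integral_interval_sub_left (hint _ _) (hint _ _), truncatedLaplace_apply,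
      duhamel, ← ContinuousLinearMap.intervalIntegral_comp_comm _
        (T.intervalIntegrable_duhamel zero_le_one (continuous_exp_smul α x).continuousOn),
      ← intervalIntegral.integral_smul]
    have := intervalIntegral.integral_comp_sub_right (a := 0) (b := 1)
      (fun s => Complex.exp (α * t) • f s) t
    rw [zero_sub] at this
    rw [← this]
    refine intervalIntegral.integral_congr fun s hs => ?_
    rw [uIcc_of_le zero_le_one] at hs
    simp only [hf]
    rw [← T.map_add_apply, ← Real.toNNReal_add ht (by linarith [hs.2]), map_smul, smul_smul,
      ← Complex.exp_add]
    congr 2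
    · push_cast
      ring
    · congr 2
      ring
  have h1 : HasDerivAt (fun t : ℝ => ∫ s in (0 : ℝ)..(1 - t), f s) (-f 1) 0 := by
    have := (hder (1 - 0)).scomp (0 : ℝ) ((hasDerivAt_id (0 : ℝ)).const_sub 1)
    simpa [Function.comp_def] using this
  have h2 : HasDerivAt (fun t : ℝ => ∫ s in (0 : ℝ)..(-t), f s) (-f 0) 0 := by
    have := (hder (-0)).scomp (0 : ℝ) (hasDerivAt_id (0 : ℝ)).neg
    simpa [Function.comp_def] using this
  have h3 : HasDerivAt (fun s : ℝ => Complex.exp (α * s)) (Complex.exp (α * (0 : ℝ)) * (α * 1)) 0 :=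
    ((Complex.ofRealCLM.hasDerivAt (x := 0)).const_mul α).cexp
  have h0 := hI 0 le_rfl
  simp only [Real.toNNReal_zero, T.map_zero_apply] at h0
  refine hasGenerator_of_hasDerivAt
    (f := fun t : ℝ => Complex.exp (α * t) •
      ((∫ s in (0 : ℝ)..(1 - t), f s) - ∫ s in (0 : ℝ)..(-t), f s)) ?_ fun t => ?_
  · have := h3.smul (h1.sub h2)
    refine this.congr_deriv ?_
    rw [h0]
    simp [hf, T.map_zero_apply]
    abel
  · rw [← hI t t.coe_nonneg, Real.toNNReal_coe]

/-- Let L be the truncated Laplace operator and N = e^α - T(1), invertible by the Neumann series.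
Then (α-A)L = N on `X` and L(α-A) = N on D(A). The first identity makes LN⁻¹ a right inverse of α-A,
the second makes α-A injective. -/
theorem mem_resolventSet_of_norm_lt {α : ℂ} (hα : ‖T 1‖ < ‖Complex.exp α‖) :
    α ∈ T.resolventSet := by
  have hu : IsUnit (algebraMap ℂ (X →L[ℂ] X) (Complex.exp α) - T 1) := by
    refine spectrum.mem_resolventSet_of_norm_lt_mul (lt_of_le_of_lt ?_ hα)
    exact mul_le_of_le_one_right (norm_nonneg _) ContinuousLinearMap.norm_id_le
  obtain ⟨N, hN⟩ := hu
  have hN' : ∀ x, (N : X →L[ℂ] X) x = Complex.exp α • x - T 1 x := fun x => by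
    rw [hN]
    simp [Algebra.algebraMap_eq_smul_one]
  have hN1 : ∀ x, (N : X →L[ℂ] X) ((↑N⁻¹ : X →L[ℂ] X) x) = x := fun x => by
    rw [← mul_apply_eq_comp, N.mul_inv, one_apply_eq_self]
  have hN2 : ∀ x, (↑N⁻¹ : X →L[ℂ] X) ((N : X →L[ℂ] X) x) = x := fun x => by
    rw [← mul_apply_eq_comp, N.inv_mul, one_apply_eq_self]
  have hinj : ∀ x y, T.HasGenerator x y → α • x - y = 0 → x = 0 := fun x y h h0 => by
    have h1 := h.truncatedLaplace α
    rw [h0, _root_.map_zero, ← hN'] at h1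
    rw [← hN2 x, ← h1, _root_.map_zero]
  have hright : ∀ x, T.HasGenerator (T.truncatedLaplace α ((↑N⁻¹ : X →L[ℂ] X) x))
      (α • T.truncatedLaplace α ((↑N⁻¹ : X →L[ℂ] X) x) - x) := fun x => by
    have := T.hasGenerator_truncatedLaplace α ((↑N⁻¹ : X →L[ℂ] X) x)
    rwa [← hN', hN1] at this
  refine ⟨(T.truncatedLaplace α).comp (↑N⁻¹ : X →L[ℂ] X), fun x => ⟨(hright x).mem, ?_⟩, fun x => ?_⟩
  · have e := (T.generator_spec ⟨_, (hright x).mem⟩).unique (hright x)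
    refine (congrArg (α • T.truncatedLaplace α ((↑N⁻¹ : X →L[ℂ] X) x) - ·) e).trans ?_
    abel
  · have h1 := (hright (T.shifted α x)).add ((T.generator_spec x).smul (-1))
    refine eq_of_sub_eq_zero ?_
    rw [sub_eq_add_neg, ← neg_one_smul ℂ (x : X)]
    refine hinj _ _ h1 ?_
    rw [ContinuousLinearMap.comp_apply,
      show T.shifted α x = α • (x : X) - T.generator x from rfl]
    module

/-- Some point of the half-plane `Re z > ω(T)` belongs to `ρ(A)`. -/
theorem exists_mem_halfPlane_mem_resolventSet : ∃ α ∈ T.halfPlane, α ∈ T.resolventSet := by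
  obtain ⟨M, hM1, hM⟩ := T.exists_norm_le 1
  -- This lets `M` itself serve as an exponential rate for T.
  have hMe : M ≤ Real.exp M := (le_add_of_nonneg_right zero_le_one).trans (Real.add_one_le_exp M)
  have hn : ∀ n : ℕ, ∀ s ≤ (1 : ℝ≥0), ‖T (n + s)‖ ≤ M * Real.exp (M * n) := by
    intro n
    induction n with
    | zero => intro s hs; simpa using hM s hs
    | succ n ih =>
      intro s hs
      have e : ((n + 1 : ℕ) : ℝ≥0) + s = 1 + (n + s) := by push_cast; ring
      rw [e, T.map_add]
      refine (ContinuousLinearMap.opNorm_comp_le _ _).trans ?_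
      calc ‖T 1‖ * ‖T (n + s)‖ ≤ Real.exp M * (M * Real.exp (M * n)) :=
            mul_le_mul ((hM 1 le_rfl).trans hMe) (ih s hs) (norm_nonneg _) (Real.exp_pos _).le
        _ = M * Real.exp (M * ((n + 1 : ℕ) : ℝ)) := by
            push_cast
            rw [mul_add, Real.exp_add, mul_one]
            ring
  have hb : ∀ t : ℝ≥0, ‖T t‖ ≤ M * Real.exp (M * t) := fun t => by
    have hf : (⌊t⌋₊ : ℝ≥0) ≤ t := Nat.floor_le zero_le
    have h1 := hn ⌊t⌋₊ (t - ⌊t⌋₊) (by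
      rw [tsub_le_iff_left]
      exact (Nat.lt_floor_add_one t).le)
    rw [add_tsub_cancel_of_le hf] at h1
    refine h1.trans ?_
    have hf' : ((⌊t⌋₊ : ℕ) : ℝ) ≤ t := by exact_mod_cast hf
    gcongr
  have hg : T.growthBound ≤ (M : EReal) := sInf_le ⟨M, rfl, M, hb⟩
  -- M + 1 exceeds the growth bound, and e^{M+1} > e^M ≥ M ≥ ‖T(1)‖.
  refine ⟨((M + 1 : ℝ) : ℂ), ?_, T.mem_resolventSet_of_norm_lt ?_⟩
  · exact lt_of_le_of_lt hg (by simpa using EReal.coe_lt_coe_iff.2 (lt_add_one M))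
  · rw [Complex.norm_exp, Complex.ofReal_re]
    refine lt_of_le_of_lt ((hM 1 le_rfl).trans hMe) (Real.exp_lt_exp.2 (lt_add_one M))

end Resolvent

end C0Semigroup

/-! ### Transport of identities from `X₋₁` to `X`. -/

namespace C0Semigroup

section Extrapolation

variable {X : Type*} [NormedAddCommGroup X] [NormedSpace ℂ X] [CompleteSpace X]
  (T : C0Semigroup X) (β : T.resolventSet)

/-- True on `X` by the choice of the norm of `X₋₁`, then everywhere by density. It makes R(β,A)
injective on `X₋₁`, so identities there can be checked in `X`. -/
theorem norm_extResolvent (ξ : T.Xm1 β) : ‖T.extResolvent β β ξ‖ = ‖ξ‖ := by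
  refine (T.denseRange_toXm1 β).induction_on ξ (isClosed_eq (by fun_prop) (by fun_prop)) fun x => ?_
  rw [T.extResolvent_toXm1 β β.2, T.norm_toXm1]

/-- The extended resolvent at `β` as a linear isometry `X₋₁ → X`. -/
def extResolventIsometry : T.Xm1 β →ₗᵢ[ℂ] X where
  toLinearMap := (T.extResolvent β β).toLinearMap
  norm_map' := T.norm_extResolvent β

theorem extResolvent_injective : Function.Injective (T.extResolvent β β) :=
  (T.extResolventIsometry β).injective

theorem extResolvent_extSemigroup (t : ℝ≥0) (ξ : T.Xm1 β) :
    T.extResolvent β β (T.extSemigroup β t ξ) = T t (T.extResolvent β β ξ) := by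
  refine (T.denseRange_toXm1 β).induction_on ξ (isClosed_eq (by fun_prop) (by fun_prop)) fun x => ?_
  rw [T.extSemigroup_toXm1, T.extResolvent_toXm1 β β.2, T.extResolvent_toXm1 β β.2,
    T.resolvent_comm β.2]

theorem extResolvent_extGenerator (x : X) :
    T.extResolvent β β (T.extGenerator β x) = (β : ℂ) • T.resolvent β x - x := by
  refine T.denseRange_domain.induction_on x (isClosed_eq (by fun_prop) (by fun_prop)) fun x => ?_
  rw [Submodule.subtype_apply, T.extGenerator_coe, T.extResolvent_toXm1 β β.2]
  have h := (T.generator_spec x).resolvent_sub β.2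
  rw [map_sub, map_smul] at h
  rw [eq_sub_iff_add_eq, ← eq_sub_iff_add_eq', h]

/-- The resolvent identity, extended by density. It links the arbitrary point `β` defining `X₋₁` to
the points of the half-plane that define the combined operator. -/
theorem extResolvent_eq {α : ℂ} (hα : α ∈ T.resolventSet) (ξ : T.Xm1 β) :
    T.extResolvent β α ξ = T.extResolvent β β ξ
      + ((β : ℂ) - α) • T.resolvent α (T.extResolvent β β ξ) := by
  refine (T.denseRange_toXm1 β).induction_on ξ (isClosed_eq (by fun_prop) (by fun_prop)) fun x => ?_
  rw [T.extResolvent_toXm1 β β.2, T.extResolvent_toXm1 β hα, T.resolvent_identity hα β.2]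

/-- An identity in `X₋₁` for the state reached from `0`, transported to `X` by `R(β, A)`. -/
theorem toXm1_eq_integral_iff (f : ℝ → T.Xm1 β) (t : ℝ) (z : X) :
    T.toXm1 β z = ∫ s in (0 : ℝ)..t, T.extSemigroup β (t - s).toNNReal (f s) ↔
      T.resolvent β z = T.duhamel (fun s => T.extResolvent β β (f s)) t := by
  have h : T.extResolvent β β (∫ s in (0 : ℝ)..t, T.extSemigroup β (t - s).toNNReal (f s))
      = T.duhamel (fun s => T.extResolvent β β (f s)) t := by
    simp only [duhamel, intervalIntegral, ← extResolvent_extSemigroup, map_sub]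
    -- A linear isometry commutes with the Bochner integral even without integrability, so `f` needs
    -- no hypothesis.
    congr 1 <;> exact ((T.extResolventIsometry β).integral_comp_comm _).symm
  rw [← (T.extResolvent_injective β).eq_iff, T.extResolvent_toXm1 β β.2, h]

end Extrapolation

end C0Semigroup

/-! ### The node equations read in `X`. -/

namespace SystemNode

variable {U X Y : Type*} [NormedAddCommGroup U] [NormedSpace ℂ U]
    [NormedAddCommGroup X] [NormedSpace ℂ X] [CompleteSpace X]
    [NormedAddCommGroup Y] [NormedSpace ℂ Y]

/-- The bounded operator `R(β, A) B : U → X`. -/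
def resB (S : SystemNode U X Y) : U →L[ℂ] X := (S.T.extResolvent S.β S.β).comp S.B

theorem state_eq_iff (S : SystemNode U X Y) (x x' : X) (u : U) :
    S.T.toXm1 S.β x' = S.T.extGenerator S.β x + S.B u ↔
      x = S.resB u + ((S.β : ℂ) • S.T.resolvent S.β x - S.T.resolvent S.β x') := by
  rw [← (S.T.extResolvent_injective S.β).eq_iff, _root_.map_add,
    S.T.extResolvent_toXm1 S.β S.β.2, S.T.extResolvent_extGenerator]
  change _ = _ + S.resB u ↔ _
  constructor <;> intro h
  · rw [h]; abel
  · rw [← sub_eq_zero] at h ⊢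
    rw [← h]
    abel

theorem admissible_iff (S : SystemNode U X Y) :
    S.T.InfiniteTimeCControlAdmissible S.β S.B ↔
      ∃ c : ℝ, 0 < c ∧ ∀ t : ℝ, 0 < t → ∀ u : ℝ → U, ContinuousOn u (Icc 0 t) →
        ∃ z : X, S.T.resolvent S.β z = S.T.duhamel (fun s => S.resB (u s)) t ∧
          ‖z‖ ≤ c * ⨆ s : Icc (0 : ℝ) t, ‖u s‖ := by
  simp only [C0Semigroup.InfiniteTimeCControlAdmissible, C0Semigroup.toXm1_eq_integral_iff]
  rfl

theorem OutputIsState.eq_of_isCD {S : SystemNode U X X} (hS : S.OutputIsState) {x y : X} {u : U}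
    (h : S.IsCD x u y) : y = x := by
  obtain ⟨-, α, hα, z, hz, rfl⟩ := h
  rw [hS.1, hS.2 α hα, hz]
  simp

/-- The state equation writes x - R(α,A)Bu as a combination of values of R(β,A) and R(α,A), hence as
an element of D(A). This needs `α` in the resolvent set as well as in the half-plane. -/
theorem OutputIsState.isCD {S : SystemNode U X X} (hS : S.OutputIsState) {x x' : X} {u : U}
    (h : S.T.toXm1 S.β x' = S.T.extGenerator S.β x + S.B u) : S.IsCD x u x := by
  obtain ⟨α, hα, hαρ⟩ := S.T.exists_mem_halfPlane_mem_resolventSet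
  have hx := (S.state_eq_iff x x' u).1 h
  have e : x - S.T.extResolvent S.β α (S.B u)
      = S.T.resolvent S.β ((S.β : ℂ) • x - x')
        - ((S.β : ℂ) - α) • S.T.resolvent α (S.resB u) := by
    rw [S.T.extResolvent_eq S.β hαρ, map_sub, map_smul]
    nth_rewrite 1 [hx]
    simp only [resB, ContinuousLinearMap.comp_apply]
    abel
  have hm : x - S.T.extResolvent S.β α (S.B u) ∈ S.T.generator.domain := by
    rw [e]
    exact Submodule.sub_mem _ ((S.T.isResolvent S.β.2).1 _).1
      (Submodule.smul_mem _ _ ((S.T.isResolvent hαρ).1 _).1)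
  refine ⟨⟨x', h⟩, α, hα, ⟨_, hm⟩, rfl, ?_⟩
  rw [hS.1, hS.2 α hα]
  exact (sub_add_cancel _ _).symm

end SystemNode

/-! ### Essential suprema of continuous functions. -/

theorem norm_le_of_ae_norm_le {E : Type*} [NormedAddCommGroup E] {f : ℝ → E} {t K : ℝ} (ht : 0 < t)
    (hf : ContinuousOn f (Icc 0 t)) (h : ∀ᵐ s ∂volume.restrict (Icc 0 t), ‖f s‖ ≤ K) :
    ∀ s ∈ Icc 0 t, ‖f s‖ ≤ K := by
  intro s hs
  -- The bound is recast as an almost everywhere equality of continuous functions, max(‖f‖, K) = K.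
  have := Measure.eqOn_Icc_of_ae_eq volume ht.ne (f := fun s => max ‖f s‖ K) (g := fun _ => K)
    (h.mono fun s hs => max_eq_right hs) (hf.norm.sup continuousOn_const) continuousOn_const hs
  exact max_eq_right_iff.1 this

theorem norm_le_toReal_eLpNorm {E : Type*} [NormedAddCommGroup E] {f : ℝ → E} {t : ℝ} (ht : 0 < t)
    (hf : ContinuousOn f (Icc 0 t)) (h : eLpNorm f ∞ (volume.restrict (Icc 0 t)) ≠ ⊤) :
    ∀ s ∈ Icc 0 t, ‖f s‖ ≤ (eLpNorm f ∞ (volume.restrict (Icc 0 t))).toReal := by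
  refine norm_le_of_ae_norm_le ht hf ?_
  filter_upwards [ae_le_eLpNormEssSup (f := f) (μ := volume.restrict (Icc 0 t))] with s hs
  rw [← toReal_enorm]
  refine ENNReal.toReal_mono h ?_
  rwa [eLpNorm_exponent_top]

theorem bddAbove_range_norm {E : Type*} [NormedAddCommGroup E] {f : ℝ → E} {t : ℝ}
    (hf : ContinuousOn f (Icc 0 t)) : BddAbove (range fun s : Icc (0 : ℝ) t => ‖f s‖) := by
  obtain ⟨C, hC⟩ := isCompact_Icc.exists_bound_of_continuousOn hf
  exact ⟨C, by rintro _ ⟨s, rfl⟩; exact hC s s.2⟩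

/-! ### Admissibility implies stability. -/

namespace SystemNode

variable {U X : Type*} [NormedAddCommGroup U] [NormedSpace ℂ U]
    [NormedAddCommGroup X] [NormedSpace ℂ X] [CompleteSpace X]

/-- The state of a classical solution is given by variation of constants. -/
theorem IsClassicalSolution.resolvent_state {Y : Type*} [NormedAddCommGroup Y] [NormedSpace ℂ Y]
    {S : SystemNode U X Y} {u : ℝ → U} {x : ℝ → X} {y : ℝ → Y} (h : S.IsClassicalSolution u x y)
    (hx0 : x 0 = 0) {t : ℝ} (ht : 0 ≤ t) :
    S.T.resolvent S.β (x t) = S.T.duhamel (fun s => S.resB (u s)) t := by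
  have hxc := h.contDiffOn_state.continuousOn
  have hx'c := h.contDiffOn_state.continuousOn_derivWithin (uniqueDiffOn_Ici 0) le_rfl
  have hsub : Icc 0 t ⊆ Ici 0 := Icc_subset_Ici_self
  have hR : Continuous (S.T.resolvent S.β) := (S.T.resolvent S.β).continuous
  -- The function h = R(β,A)x takes values in D(A) with Ah = βh - x, and the state equation turns h'
  -- - Ah into R(β,A)Bu.
  have key := S.T.duhamel_eq_sub (h := fun s => S.T.resolvent S.β (x s))
    (h' := fun s => S.T.resolvent S.β (derivWithin x (Ici 0) s))
    (a := fun s => (S.β : ℂ) • S.T.resolvent S.β (x s) - x s) ht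
    (hR.comp_continuousOn (hxc.mono hsub)) (hR.comp_continuousOn (hx'c.mono hsub))
    (((hR.comp_continuousOn (hxc.mono hsub)).const_smul _).sub (hxc.mono hsub))
    (fun s _ => S.T.hasGenerator_resolvent S.β.2 _)
    (fun s hs => by
      have hd := (h.contDiffOn_state.differentiableOn one_ne_zero s hs.1.le).hasDerivWithinAt
      exact (((S.T.resolvent S.β).restrictScalars ℝ).hasFDerivAt.comp_hasDerivWithinAt s hd).mono
        fun r hr => hs.1.le.trans (le_of_lt hr))
  rw [hx0, _root_.map_zero, _root_.map_zero, sub_zero] at key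
  rw [← key]
  refine S.T.duhamel_congr ht fun s hs => ?_
  have := (S.state_eq_iff _ _ _).1 (h.state_eq s (hsub hs))
  rw [← sub_eq_zero] at this ⊢
  rw [← this]
  abel

theorem OutputIsState.isSmoothBIBOStable {S : SystemNode U X X} (hS : S.OutputIsState)
    (hB : S.T.InfiniteTimeCControlAdmissible S.β S.B) : S.IsSmoothBIBOStable := by
  obtain ⟨c, hc, hB⟩ := S.admissible_iff.1 hB
  refine ⟨c, hc, fun u x y hu _ _ h hx0 t ht => ?_⟩
  have hyc : ContinuousOn y (Icc 0 t) := h.continuousOn_output.mono Icc_subset_Ici_self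
  have hbound : ∀ s ∈ Icc 0 t, ‖y s‖ ≤ c * ⨆ r : Icc (0 : ℝ) s, ‖u r‖ := by
    intro s hs
    rw [hS.eq_of_isCD (h.output_eq s hs.1)]
    -- Admissibility speaks of positive times only.
    rcases hs.1.eq_or_lt with rfl | hs0
    · rw [hx0, norm_zero]
      exact mul_nonneg hc.le (Real.iSup_nonneg fun _ => norm_nonneg _)
    · obtain ⟨z, hz, hzn⟩ := hB s hs0 u hu.continuous.continuousOn
      rw [← h.resolvent_state hx0 hs.1] at hz
      rwa [← S.T.resolvent_injective S.β.2 hz]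
  constructor
  · obtain ⟨C, hC⟩ := isCompact_Icc.exists_bound_of_continuousOn hyc
    exact MemLp.of_bound (hyc.aestronglyMeasurable measurableSet_Icc) C
      ((ae_restrict_iff' measurableSet_Icc).2 (ae_of_all _ hC))
  · by_cases htop : eLpNorm u ∞ (volume.restrict (Icc 0 t)) = ⊤
    · rw [htop, ENNReal.mul_top (by simpa using hc)]
      exact le_top
    · have hK := norm_le_toReal_eLpNorm ht hu.continuous.continuousOn htop
      set K := (eLpNorm u ∞ (volume.restrict (Icc 0 t))).toReal with hKdef
      rw [← ENNReal.ofReal_toReal htop, ← hKdef, ← ENNReal.ofReal_mul hc.le, eLpNorm_exponent_top]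
      refine eLpNormEssSup_le_of_ae_bound
        ((ae_restrict_iff' measurableSet_Icc).2 (ae_of_all _ fun s hs => ?_))
      refine (hbound s hs).trans (mul_le_mul_of_nonneg_left ?_ hc.le)
      exact Real.iSup_le (fun r => hK r ⟨r.2.1, r.2.2.trans hs.2⟩) ENNReal.toReal_nonneg

end SystemNode

/-! ### Regularity and limits of the variation of constants integral. -/

namespace C0Semigroup

section Duhamel

variable {X : Type*} [NormedAddCommGroup X] [NormedSpace ℂ X] (T : C0Semigroup X)

theorem duhamel_eq_integral_sub (g : ℝ → X) (t : ℝ) :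
    T.duhamel g t = ∫ r in (0 : ℝ)..t, T r.toNNReal (g (t - r)) := by
  have := intervalIntegral.integral_comp_sub_left (a := 0) (b := t)
    (fun r => T r.toNNReal (g (t - r))) t
  simpa [duhamel] using this

theorem norm_duhamel_le {g : ℝ → X} {t M K : ℝ} (ht : 0 ≤ t) (hM0 : 0 ≤ M)
    (hM : ∀ s ≤ t.toNNReal, ‖T s‖ ≤ M) (hK : ∀ s ∈ Icc 0 t, ‖g s‖ ≤ K) :
    ‖T.duhamel g t‖ ≤ M * K * t := by
  refine (intervalIntegral.norm_integral_le_of_norm_le_const (C := M * K) fun s hs => ?_).trans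
    (by rw [sub_zero, abs_of_nonneg ht])
  rw [uIoc_of_le ht] at hs
  exact (ContinuousLinearMap.le_opNorm _ _).trans
    (mul_le_mul (hM _ (Real.toNNReal_le_toNNReal (by linarith [hs.1])))
      (hK s (Ioc_subset_Icc_self hs)) (norm_nonneg _) hM0)

variable [CompleteSpace X]

theorem continuous_conv_integrand {g : ℝ → X} (hg : Continuous g) (t : ℝ) :
    Continuous fun r : ℝ => T r.toNNReal (g (t - r)) :=
  T.continuous_uncurry.comp
    (continuous_id.prodMk (hg.comp (continuous_const.sub continuous_id)))

/-- The integrand vanishes for r ≥ t. Freezing the upper limit prepares differentiation under the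
integral sign. -/
theorem duhamel_eq_integral_of_le {g : ℝ → X} (hg : Continuous g) (h0 : ∀ s ≤ 0, g s = 0)
    {t N : ℝ} (htN : t ≤ N) : T.duhamel g t = ∫ r in (0 : ℝ)..N, T r.toNNReal (g (t - r)) := by
  have hi : ∀ a b, IntervalIntegrable (fun r : ℝ => T r.toNNReal (g (t - r))) volume a b :=
    fun a b => (T.continuous_conv_integrand hg t).intervalIntegrable a b
  rw [T.duhamel_eq_integral_sub, ← intervalIntegral.integral_add_adjacent_intervals (hi 0 t) (hi t N),
    left_eq_add]
  refine (intervalIntegral.integral_congr (g := fun _ => (0 : X)) fun r hr => ?_).trans (by simp)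
  rw [uIcc_of_le htN] at hr
  simp only [h0 (t - r) (by linarith [hr.1]), _root_.map_zero]

theorem hasDerivAt_duhamel {g g' : ℝ → X} (hg : ∀ s, HasDerivAt g (g' s) s) (hg' : Continuous g')
    (h0 : ∀ s ≤ 0, g s = 0) (h0' : ∀ s ≤ 0, g' s = 0) (t : ℝ) :
    HasDerivAt (T.duhamel g) (T.duhamel g' t) t := by
  have hgc : Continuous g := continuous_iff_continuousAt.2 fun s => (hg s).continuousAt
  -- One window [0,N] serves all times within distance 1 of `t`.
  set N := max (t + 1) 0 with hN
  have hN0 : 0 ≤ N := le_max_right _ _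
  have htN : t + 1 ≤ N := le_max_left _ _
  obtain ⟨M, hM1, hM⟩ := T.exists_norm_le N.toNNReal
  obtain ⟨C, hC⟩ := (isCompact_Icc (a := t - 1 - N) (b := t + 1)).exists_bound_of_continuousOn
    hg'.continuousOn
  have key := (intervalIntegral.hasDerivAt_integral_of_dominated_loc_of_deriv_le
    (F := fun x r : ℝ => T r.toNNReal (g (x - r))) (F' := fun x r => T r.toNNReal (g' (x - r)))
    (x₀ := t) (a := 0) (b := N) (μ := volume) (bound := fun _ => M * C)
    (Metric.ball_mem_nhds t one_pos)
    (Eventually.of_forall fun x => (T.continuous_conv_integrand hgc x).aestronglyMeasurable)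
    ((T.continuous_conv_integrand hgc t).intervalIntegrable _ _)
    (T.continuous_conv_integrand hg' t).aestronglyMeasurable
    (ae_of_all _ fun r hr x hx => by
      rw [uIoc_of_le hN0] at hr
      rw [Real.ball_eq_Ioo] at hx
      have h1 := hM r.toNNReal (Real.toNNReal_le_toNNReal hr.2)
      have h2 := hC (x - r) ⟨by linarith [hx.1, hr.2], by linarith [hx.2, hr.1]⟩
      exact (ContinuousLinearMap.le_opNorm _ _).trans
        (mul_le_mul h1 h2 (norm_nonneg _) (zero_le_one.trans hM1)))
    intervalIntegrable_const
    (ae_of_all _ fun r _ x _ => by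
      have h1 : HasDerivAt (fun x => g (x - r)) (g' (x - r)) x := (hg (x - r)).comp_sub_const x r
      exact ((T r.toNNReal).restrictScalars ℝ).hasFDerivAt.comp_hasDerivAt x h1)).2
  rw [← T.duhamel_eq_integral_of_le hg' h0' (by linarith)] at key
  refine key.congr_of_eventuallyEq ?_
  filter_upwards [Iio_mem_nhds (lt_add_one t)] with x hx
  exact T.duhamel_eq_integral_of_le hgc h0 ((le_of_lt hx).trans htN)

/-- If `g ∈ C¹` with `g(0) = 0`, then `∫₀ᵗ T(t - s) g(s) ds` lies in `D(A)`. -/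
theorem resolvent_duhamel (β : T.resolventSet) {g g' : ℝ → X} (hg : ∀ s, HasDerivAt g (g' s) s)
    (hg' : Continuous g') (h0 : g 0 = 0) {t : ℝ} (ht : 0 ≤ t) :
    T.resolvent β ((β : ℂ) • T.duhamel g t + g t - T.duhamel g' t) = T.duhamel g t := by
  have hgc : Continuous g := continuous_iff_continuousAt.2 fun s => (hg s).continuousAt
  have hR : Continuous (T.resolvent β) := (T.resolvent β).continuous
  have h1 : Continuous fun s => T.resolvent β (g s) := hR.comp hgc
  have h2 : Continuous fun s => T.resolvent β (g' s) := hR.comp hg'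
  have h3 : Continuous fun s => (β : ℂ) • T.resolvent β (g s) := h1.const_smul _
  have h4 : Continuous fun s => (β : ℂ) • T.resolvent β (g s) - g s := h3.sub hgc
  -- Integration by parts for T(t-s)R(β,A)g(s); the boundary term at 0 vanishes as g(0) = 0.
  have key := T.duhamel_eq_sub (h := fun s => T.resolvent β (g s))
    (h' := fun s => T.resolvent β (g' s)) (a := fun s => (β : ℂ) • T.resolvent β (g s) - g s) ht
    h1.continuousOn h2.continuousOn h4.continuousOn
    (fun s _ => T.hasGenerator_resolvent β.2 _)
    (fun s _ => (((T.resolvent β).restrictScalars ℝ).hasFDerivAt.comp_hasDerivAt s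
      (hg s)).hasDerivWithinAt)
  rw [h0, _root_.map_zero, _root_.map_zero, sub_zero,
    T.duhamel_sub ht h2.continuousOn h4.continuousOn,
    T.duhamel_sub ht h3.continuousOn hgc.continuousOn, T.duhamel_smul,
    ← T.map_duhamel _ (fun t x => T.resolvent_comm β.2 t x) ht hgc.continuousOn,
    ← T.map_duhamel _ (fun t x => T.resolvent_comm β.2 t x) ht hg'.continuousOn] at key
  rw [map_sub, _root_.map_add, map_smul, ← key]
  abel

/-- Dominated convergence. The point 0 is left out of the limit hypothesis because the cut-offs used
later all vanish there. -/
theorem tendsto_duhamel {ι : Type*} {l : Filter ι} [l.IsCountablyGenerated] {g : ι → ℝ → X}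
    {g₀ : ℝ → X} {t K : ℝ} (ht : 0 ≤ t) (hg : ∀ i, ContinuousOn (g i) (Icc 0 t))
    (hK : ∀ i, ∀ s ∈ Icc 0 t, ‖g i s‖ ≤ K)
    (hlim : ∀ s ∈ Ioc 0 t, Tendsto (fun i => g i s) l (𝓝 (g₀ s))) :
    Tendsto (fun i => T.duhamel (g i) t) l (𝓝 (T.duhamel g₀ t)) := by
  obtain ⟨M, hM1, hM⟩ := T.exists_norm_le t.toNNReal
  refine intervalIntegral.tendsto_integral_filter_of_dominated_convergence (fun _ => M * K)
    (Eventually.of_forall fun i => ?_) (Eventually.of_forall fun i => ae_of_all _ fun s hs => ?_)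
    intervalIntegrable_const (ae_of_all _ fun s hs => ?_)
  · rw [uIoc_of_le ht]
    exact ((T.continuousOn_duhamel_integrand t (hg i)).mono
      Ioc_subset_Icc_self).aestronglyMeasurable measurableSet_Ioc
  · rw [uIoc_of_le ht] at hs
    exact (ContinuousLinearMap.le_opNorm _ _).trans
      (mul_le_mul (hM _ (Real.toNNReal_le_toNNReal (by linarith [hs.1])))
        (hK i s (Ioc_subset_Icc_self hs)) (norm_nonneg _) (zero_le_one.trans hM1))
  · rw [uIoc_of_le ht] at hs
    exact ((T (t - s).toNNReal).continuous.tendsto _).comp (hlim s hs)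

/-- The evolution property of the variation of constants integral. -/
theorem duhamel_add_time {g : ℝ → X} {r t : ℝ} (hr : 0 ≤ r) (ht : 0 ≤ t)
    (hg : ContinuousOn g (Icc 0 (r + t))) :
    T.duhamel g (r + t) = T t.toNNReal (T.duhamel g r) + T.duhamel (fun s => g (s + r)) t := by
  have hi := T.continuousOn_duhamel_integrand (r + t) hg
  have h1 : T t.toNNReal (T.duhamel g r)
      = ∫ s in (0 : ℝ)..r, T (r + t - s).toNNReal (g s) := by
    rw [duhamel, ← ContinuousLinearMap.intervalIntegral_comp_comm _
      (T.intervalIntegrable_duhamel hr (hg.mono (Icc_subset_Icc_right (by linarith))))]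
    refine intervalIntegral.integral_congr fun s hs => ?_
    rw [uIcc_of_le hr] at hs
    rw [← T.map_add_apply, ← Real.toNNReal_add ht (by linarith [hs.2])]
    congr 3
    ring
  have h2 : T.duhamel (fun s => g (s + r)) t
      = ∫ s in r..(r + t), T (r + t - s).toNNReal (g s) := by
    have := intervalIntegral.integral_comp_add_right (a := 0) (b := t)
      (fun s => T (r + t - s).toNNReal (g s)) r
    rw [zero_add, add_comm t r] at this
    rw [← this, duhamel]
    refine intervalIntegral.integral_congr fun s _ => ?_
    congr 3
    ring
  rw [h1, h2, intervalIntegral.integral_add_adjacent_intervals]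
  · rfl
  · exact (hi.mono (by rw [uIcc_of_le hr]; exact Icc_subset_Icc_right (by linarith))).intervalIntegrable
  · exact (hi.mono (by
      rw [uIcc_of_le (by linarith)]; exact Icc_subset_Icc_left hr)).intervalIntegrable

/-- Bounded sets are, up to a constant, closed for the norm of `X₋₁`. -/
theorem exists_norm_le_of_tendsto_resolvent (β : T.resolventSet) :
    ∃ M : ℝ, 1 ≤ M ∧ ∀ (x : ℕ → X) (z : X) (C : ℝ),
      Tendsto (fun n => T.resolvent β (x n)) atTop (𝓝 (T.resolvent β z)) →
      (∀ n, ‖x n‖ ≤ C) → ‖z‖ ≤ M * C := by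
  obtain ⟨M, hM1, hM⟩ := T.exists_norm_le 1
  refine ⟨M, hM1, fun x z C hx hC => ?_⟩
  -- The orbit average of `y` depends continuously on R(β,A)y alone. Averages of `x n` therefore
  -- converge to those of `z`, which inherit the bound M·C·h; dividing by `h` and letting h → 0
  -- recovers `z`.
  have hR : ∀ (h : ℝ), 0 ≤ h → ∀ y : X, T.duhamel (fun _ => y) h
      = (β : ℂ) • T.duhamel (fun _ => T.resolvent β y) h + T.resolvent β y
        - T h.toNNReal (T.resolvent β y) := by
    intro h hh y
    have key := T.duhamel_eq_sub (h := fun _ => T.resolvent β y) (h' := fun _ => 0)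
      (a := fun _ => (β : ℂ) • T.resolvent β y - y) hh continuousOn_const continuousOn_const
      continuousOn_const (fun s _ => T.hasGenerator_resolvent β.2 y)
      (fun s _ => hasDerivWithinAt_const _ _ _)
    simp only [zero_sub, neg_sub] at key
    rw [T.duhamel_sub hh continuousOn_const continuousOn_const, T.duhamel_smul] at key
    rw [add_sub_assoc, ← key]
    abel
  obtain ⟨K, hK⟩ := hx.norm.bddAbove_range
  have hlim : ∀ h : ℝ, 0 ≤ h → Tendsto (fun n => T.duhamel (fun _ => x n) h) atTop
      (𝓝 (T.duhamel (fun _ => z) h)) := by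
    intro h hh
    rw [hR h hh z, funext fun n => hR h hh (x n)]
    refine ((Tendsto.const_smul ?_ _).add hx).sub (((T _).continuous.tendsto _).comp hx)
    exact T.tendsto_duhamel (K := K) hh (fun n => continuousOn_const)
      (fun n s _ => hK ⟨n, rfl⟩) (fun s _ => hx)
  have hle : ∀ h : ℝ, 0 ≤ h → h ≤ 1 → ‖T.duhamel (fun _ => z) h‖ ≤ M * C * h := by
    intro h hh h1
    refine le_of_tendsto (hlim h hh).norm (Eventually.of_forall fun n => ?_)
    exact T.norm_duhamel_le hh (zero_le_one.trans hM1)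
      (fun s hs => hM s (hs.trans (by simpa using h1))) (fun s _ => hC n)
  have hc : Continuous fun r : ℝ => T r.toNNReal z :=
    (T.continuous_orbit z).comp continuous_real_toNNReal
  have hd : HasDerivAt (fun h => T.duhamel (fun _ => z) h) z 0 := by
    have := intervalIntegral.integral_hasDerivAt_right (hc.intervalIntegrable 0 0)
      hc.stronglyMeasurable.stronglyMeasurableAtFilter hc.continuousAt
    simp only [Real.toNNReal_zero, T.map_zero_apply] at this
    simpa only [T.duhamel_eq_integral_sub] using this
  have hs := hd.tendsto_slope_zero_right
  refine le_of_tendsto hs.norm ?_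
  filter_upwards [Ioo_mem_nhdsGT one_pos] with h hh
  have h0 : T.duhamel (fun _ => z) 0 = 0 := by simp [duhamel]
  rw [zero_add, h0, sub_zero, norm_smul, norm_inv, Real.norm_of_nonneg hh.1.le,
    inv_mul_le_iff₀ hh.1, mul_comm h]
  exact hle h hh.1.le hh.2.le

end Duhamel

end C0Semigroup

/-! ### Smooth inputs supported in (0,∞) and approximation by them. -/

theorem iteratedDeriv_eq_zero_of_tsupport_subset_Ioi {E : Type*} [NormedAddCommGroup E]
    [NormedSpace ℝ E] {u : ℝ → E} (hs : tsupport u ⊆ Ioi 0) (n : ℕ) {s : ℝ} (h : s ≤ 0) :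
    iteratedDeriv n u s = 0 := by
  have h1 : u =ᶠ[𝓝 s] fun _ => 0 := notMem_tsupport_iff_eventuallyEq.1 fun hm => not_lt.2 h (hs hm)
  rw [h1.iteratedDeriv_eq]
  simp [iteratedDeriv_fun_const_zero]

/-- A continuous function on `[0, t]` that vanishes at `0` is a uniform limit of smooth functions
with compact support in `(0, ∞)`. -/
theorem exists_contDiff_hasCompactSupport_norm_sub_le {E : Type*} [NormedAddCommGroup E]
    [NormedSpace ℝ E] {u : ℝ → E} {t ε : ℝ} (ht : 0 < t) (hε : 0 < ε)
    (hu : ContinuousOn u (Icc 0 t)) (hu0 : u 0 = 0) :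
    ∃ g : ℝ → E, ContDiff ℝ ∞ g ∧ HasCompactSupport g ∧ tsupport g ⊆ Ioi 0 ∧
      ∀ s ∈ Icc 0 t, ‖g s - u s‖ ≤ ε := by
  set v : ℝ → E := fun s => u (max 0 (min s t)) with hv
  have hvc : Continuous v := hu.comp_continuous (by fun_prop)
    fun s => ⟨le_max_left _ _, max_le ht.le (min_le_right _ _)⟩
  have hvu : ∀ s ∈ Icc 0 t, v s = u s := fun s hs => by
    simp only [hv, min_eq_left hs.2, max_eq_right hs.1]
  have hv0 : v 0 = 0 := by rw [hvu 0 ⟨le_rfl, ht.le⟩, hu0]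
  obtain ⟨δ, hδ, hvδ⟩ := Metric.continuousAt_iff.1 hvc.continuousAt (ε / 2) (half_pos hε)
  -- The cut-off is 1 on [δ,t] and 0 outside (δ/2,t+1). On [0,δ), where `u` has norm below ε/2, it
  -- costs at most ε/2.
  set θ : ℝ → ℝ := fun s => max 0 (min 1 (min (2 * s / δ - 1) (t + 1 - s))) with hθ
  have hθ0 : ∀ s, 0 ≤ θ s := fun s => le_max_left _ _
  have hθ1 : ∀ s, θ s ≤ 1 := fun s => max_le zero_le_one (min_le_left _ _)
  have hf : Continuous fun s => θ s • v s := by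
    have : Continuous θ := by fun_prop
    exact this.smul hvc
  -- The smooth approximation keeps its support inside that of θv, hence away from 0.
  obtain ⟨g, hg, hgd, hgs⟩ := hf.exists_contDiff_approx ⊤ (ε := fun _ => ε / 2) continuous_const
    fun _ => half_pos hε
  have hsupp : tsupport g ⊆ Icc (δ / 2) (t + 1) := by
    refine closure_minimal (hgs.trans fun s hs => ?_) isClosed_Icc
    have h1 : θ s ≠ 0 := fun h => hs (by simp [h])
    by_contra hmem
    refine h1 (max_eq_left ?_)
    rw [mem_Icc, not_and_or, not_le, not_le] at hmem
    rcases hmem with h | h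
    · refine (min_le_right _ _).trans ((min_le_left _ _).trans ?_)
      rw [sub_nonpos, div_le_one hδ]
      linarith
    · exact (min_le_right _ _).trans ((min_le_right _ _).trans (by linarith))
  refine ⟨g, hg, HasCompactSupport.of_support_subset_isCompact isCompact_Icc
    ((subset_tsupport g).trans hsupp), fun s hs => lt_of_lt_of_le (half_pos hδ) (hsupp hs).1,
    fun s hs => ?_⟩
  have h1 := (hgd s).le
  rw [dist_eq_norm] at h1
  have h2 : ‖θ s • v s - u s‖ ≤ ε / 2 := by
    rw [← hvu s hs]
    rcases lt_or_ge s δ with h | h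
    · have h3 : ‖v s‖ < ε / 2 := by
        have := hvδ (x := s) (by rwa [Real.dist_eq, sub_zero, abs_of_nonneg hs.1])
        rwa [hv0, dist_zero_right] at this
      rw [show θ s • v s - v s = (θ s - 1) • v s by module, norm_smul, Real.norm_eq_abs]
      have h4 : |θ s - 1| ≤ 1 := abs_le.2 ⟨by linarith [hθ0 s], by linarith [hθ1 s]⟩
      exact (mul_le_of_le_one_left (norm_nonneg _) h4).trans h3.le
    · have h3 : θ s = 1 := by
        have h4 : 1 ≤ 2 * s / δ - 1 := by
          rw [le_sub_iff_add_le, le_div_iff₀ hδ]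
          linarith
        simp only [hθ]
        rw [min_eq_left (le_min h4 (by linarith [hs.2])), max_eq_right zero_le_one]
      rw [h3, one_smul, sub_self, norm_zero]
      exact (half_pos hε).le
  calc ‖g s - u s‖ = ‖(g s - θ s • v s) + (θ s • v s - u s)‖ := by rw [sub_add_sub_cancel]
    _ ≤ ε / 2 + ε / 2 := (norm_add_le _ _).trans (add_le_add h1 h2)
    _ = ε := add_halves ε

/-! ### Stability implies admissibility. -/

namespace SystemNode

variable {U X : Type*} [NormedAddCommGroup U] [NormedSpace ℂ U]
    [NormedAddCommGroup X] [NormedSpace ℂ X] [CompleteSpace X]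

/-- Smooth inputs with compact support in `(0, ∞)` have a classical solution starting at `0`. -/
theorem OutputIsState.exists_isClassicalSolution {S : SystemNode U X X} (hS : S.OutputIsState)
    {u : ℝ → U} (hu : ContDiff ℝ ∞ u) (hs : tsupport u ⊆ Ioi 0) :
    ∃ x : ℝ → X, S.IsClassicalSolution u x x ∧ x 0 = 0 := by
  set g : ℕ → ℝ → X := fun n s => S.resB (iteratedDeriv n u s) with hgdef
  have hg : ∀ n s, HasDerivAt (g n) (g (n + 1) s) s := fun n s => by
    have h1 : HasDerivAt (iteratedDeriv n u) (iteratedDeriv (n + 1) u s) s := by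
      rw [iteratedDeriv_succ]
      exact ((hu.differentiable_iteratedDeriv n (by exact_mod_cast ENat.natCast_lt_top n)) s).hasDerivAt
    exact (S.resB.restrictScalars ℝ).hasFDerivAt.comp_hasDerivAt s h1
  have hgc : ∀ n, Continuous (g n) := fun n =>
    continuous_iff_continuousAt.2 fun s => (hg n s).continuousAt
  have hg0 : ∀ n, ∀ s ≤ 0, g n s = 0 := fun n s h => by
    simp only [hgdef, iteratedDeriv_eq_zero_of_tsupport_subset_Ioi hs n h, _root_.map_zero]
  have hV : ∀ n t, HasDerivAt (S.T.duhamel (g n)) (S.T.duhamel (g (n + 1)) t) t := fun n t =>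
    S.T.hasDerivAt_duhamel (hg n) (hgc (n + 1)) (hg0 n) (hg0 (n + 1)) t
  -- With V = `S.T.duhamel (g n)` and V' = AV + g, this is (β-A)V. Differentiating raises `n` by
  -- one, so `x 0` is the state and `x 1` its derivative.
  set x : ℕ → ℝ → X := fun n t =>
    (S.β : ℂ) • S.T.duhamel (g n) t + g n t - S.T.duhamel (g (n + 1)) t with hx
  have hRx : ∀ n, ∀ t, 0 ≤ t → S.T.resolvent S.β (x n t) = S.T.duhamel (g n) t := fun n t ht =>
    S.T.resolvent_duhamel S.β (hg n) (hgc (n + 1)) (hg0 n 0 le_rfl) ht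
  have hxd : ∀ n t, HasDerivAt (x n) (x (n + 1) t) t := fun n t =>
    (((hV n t).const_smul _).add (hg n t)).sub (hV (n + 1) t)
  have hxc : ∀ n, Continuous (x n) := fun n =>
    continuous_iff_continuousAt.2 fun s => (hxd n s).continuousAt
  have hx1 : ContDiff ℝ 1 (x 0) := by
    refine contDiff_one_iff_deriv.2 ⟨fun t => (hxd 0 t).differentiableAt, ?_⟩
    rw [funext fun t => (hxd 0 t).deriv]
    exact hxc 1
  have heq : ∀ t ∈ Ici (0 : ℝ), S.T.toXm1 S.β (derivWithin (x 0) (Ici 0) t)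
      = S.T.extGenerator S.β (x 0 t) + S.B (u t) := fun t ht => by
    rw [(hxd 0 t).hasDerivWithinAt.derivWithin (uniqueDiffOn_Ici 0 t ht), S.state_eq_iff,
      hRx 0 t ht, hRx 1 t ht]
    simp only [hx, hgdef, iteratedDeriv_zero]
    abel
  exact ⟨x 0, ⟨hu.continuous.continuousOn, hx1.contDiffOn, (hxc 0).continuousOn, heq,
    fun t ht => hS.isCD (heq t ht)⟩, by simp [hx, hg0, C0Semigroup.duhamel]⟩

variable (S : SystemNode U X X)

/-- The reached state `z` at time `t` exists in `X` and has norm at most `c ‖u‖_∞`. -/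
def Reaches (c t : ℝ) (u : ℝ → U) : Prop :=
  ∃ z : X, S.T.resolvent S.β z = S.T.duhamel (fun s => S.resB (u s)) t ∧
    ∀ K : ℝ, (∀ s ∈ Icc 0 t, ‖u s‖ ≤ K) → ‖z‖ ≤ c * K

variable {S}

/-- Stability applies to the explicit solution; continuity of the state turns the essential bound on
[0,t] into one at the endpoint. -/
theorem OutputIsState.exists_reaches_smooth (hS : S.OutputIsState) (h : S.IsSmoothBIBOStable) :
    ∃ c : ℝ, 0 < c ∧ ∀ t : ℝ, 0 < t → ∀ u : ℝ → U, ContDiff ℝ ∞ u → HasCompactSupport u →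
      tsupport u ⊆ Ioi 0 → S.Reaches c t u := by
  obtain ⟨c, hc, h⟩ := h
  refine ⟨c, hc, fun t ht u hu hcs hs => ?_⟩
  obtain ⟨x, hx, hx0⟩ := hS.exists_isClassicalSolution hu hs
  refine ⟨x t, hx.resolvent_state hx0 ht.le, fun K hK => ?_⟩
  have hK0 : 0 ≤ K := (norm_nonneg _).trans (hK t ⟨ht.le, le_rfl⟩)
  have h1 := (h u x x hu hcs hs hx hx0 t ht).2
  have h2 : eLpNorm u ⊤ (volume.restrict (Icc 0 t)) ≤ ENNReal.ofReal K := by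
    rw [eLpNorm_exponent_top]
    exact eLpNormEssSup_le_of_ae_bound ((ae_restrict_iff' measurableSet_Icc).2 (ae_of_all _ hK))
  have h3 : eLpNorm x ⊤ (volume.restrict (Icc 0 t)) ≤ ENNReal.ofReal (c * K) := by
    rw [ENNReal.ofReal_mul hc.le]
    exact h1.trans (by gcongr)
  refine (norm_le_toReal_eLpNorm ht (hx.continuousOn_output.mono Icc_subset_Ici_self)
    (ne_top_of_le_ne_top ENNReal.ofReal_ne_top h3) t ⟨ht.le, le_rfl⟩).trans ?_
  exact ENNReal.toReal_le_of_le_ofReal (mul_nonneg hc.le hK0) h3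

/-- The difference of two smooth approximations is again an allowed input, so their reached states
form a Cauchy sequence in `X`. Its limit is identified after applying R(β,A). -/
theorem reaches_of_eq_zero {c : ℝ}
    (h : ∀ t : ℝ, 0 < t → ∀ u : ℝ → U, ContDiff ℝ ∞ u → HasCompactSupport u →
      tsupport u ⊆ Ioi 0 → S.Reaches c t u) {t : ℝ} (ht : 0 < t) {u : ℝ → U}
    (hu : ContinuousOn u (Icc 0 t)) (hu0 : u 0 = 0) : S.Reaches c t u := by
  have hb : ∀ {v : ℝ → U}, ContinuousOn v (Icc 0 t) →
      ContinuousOn (fun s => S.resB (v s)) (Icc 0 t) := fun hv =>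
    S.resB.continuous.comp_continuousOn hv
  have hε : ∀ n : ℕ, (0 : ℝ) < 1 / ((n : ℝ) + 1) := fun n => by positivity
  have hεlim := tendsto_one_div_add_atTop_nhds_zero_nat (𝕜 := ℝ)
  choose g hg hgc hgs hgu using fun n : ℕ =>
    exists_contDiff_hasCompactSupport_norm_sub_le ht (hε n) hu hu0
  choose z hz hzn using fun n => h t ht (g n) (hg n) (hgc n) (hgs n)
  have hcau : CauchySeq z := by
    refine cauchySeq_of_le_tendsto_0 (fun N : ℕ => c * (1 / ((N : ℝ) + 1) + 1 / ((N : ℝ) + 1)))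
      (fun n m N hn hm => ?_) (by simpa using (hεlim.add hεlim).const_mul c)
    obtain ⟨w, hw, hwn⟩ := h t ht (g n - g m) ((hg n).sub (hg m)) ((hgc n).sub (hgc m))
      ((tsupport_sub _ _).trans (union_subset (hgs n) (hgs m)))
    have hwz : w = z n - z m := by
      refine S.T.resolvent_injective S.β.2 ?_
      rw [hw, map_sub, hz, hz, ← S.T.duhamel_sub ht.le (hb (hg n).continuous.continuousOn)
        (hb (hg m).continuous.continuousOn)]
      simp only [Pi.sub_apply, map_sub]
    rw [dist_eq_norm, ← hwz]
    refine hwn _ fun s hs => ?_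
    have e : (g n - g m) s = (g n s - u s) - (g m s - u s) := by simp
    rw [e]
    refine (norm_sub_le _ _).trans (add_le_add ((hgu n s hs).trans ?_) ((hgu m s hs).trans ?_))
    · exact Nat.one_div_le_one_div hn
    · exact Nat.one_div_le_one_div hm
  obtain ⟨z₀, hz₀⟩ := cauchySeq_tendsto_of_complete hcau
  obtain ⟨C, hC⟩ := isCompact_Icc.exists_bound_of_continuousOn hu
  have hlim : Tendsto (fun n => S.T.duhamel (fun s => S.resB (g n s)) t) atTop
      (𝓝 (S.T.duhamel (fun s => S.resB (u s)) t)) := by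
    refine S.T.tendsto_duhamel (K := ‖S.resB‖ * (1 + C)) ht.le
      (fun n => hb (hg n).continuous.continuousOn) (fun n s hs => ?_) fun s hs => ?_
    · refine (S.resB.le_opNorm _).trans (mul_le_mul_of_nonneg_left ?_ (norm_nonneg _))
      have e : g n s = (g n s - u s) + u s := by simp
      rw [e]
      refine (norm_add_le _ _).trans (add_le_add ((hgu n s hs).trans ?_) (hC s hs))
      rw [div_le_one (by positivity)]
      linarith [(Nat.cast_nonneg n : (0 : ℝ) ≤ n)]
    · refine (S.resB.continuous.tendsto _).comp (tendsto_iff_norm_sub_tendsto_zero.2 ?_)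
      exact squeeze_zero (fun _ => norm_nonneg _) (fun n => hgu n s (Ioc_subset_Icc_self hs)) hεlim
  refine ⟨z₀, ?_, fun K hK => ?_⟩
  · refine tendsto_nhds_unique (((S.T.resolvent S.β).continuous.tendsto _).comp hz₀) ?_
    simpa only [Function.comp_def, hz] using hlim
  · refine le_of_tendsto_of_tendsto' (b := atTop) hz₀.norm
      (g := fun n : ℕ => c * (1 / ((n : ℝ) + 1) + K)) ?_ fun n => hzn n _ fun s hs => ?_
    · simpa using (hεlim.add_const K).const_mul c
    · have e : g n s = (g n s - u s) + u s := by simp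
      rw [e]
      exact (norm_add_le _ _).trans (add_le_add (hgu n s hs) (hK s hs))

/-- Only existence is claimed: the state is obtained by subtracting T(t)z₂, and ‖T(t)‖ need not be
bounded in `t`. -/
theorem exists_resolvent_eq_duhamel {c : ℝ}
    (h : ∀ t : ℝ, 0 < t → ∀ u : ℝ → U, ContinuousOn u (Icc 0 t) → u 0 = 0 → S.Reaches c t u)
    {t : ℝ} (ht : 0 < t) {u : ℝ → U} (hu : ContinuousOn u (Icc 0 t)) :
    ∃ z : X, S.T.resolvent S.β z = S.T.duhamel (fun s => S.resB (u s)) t := by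
  -- On [0,1] this is the ramp s·u(0), on [1,1+t] it is u(s-1).
  set v : ℝ → U := fun s => min s 1 • u (max (s - 1) 0) with hv
  have hvc : ContinuousOn v (Icc 0 (1 + t)) := by
    have hmin : Continuous fun s : ℝ => min s 1 := by fun_prop
    refine hmin.continuousOn.smul (hu.comp (by fun_prop) fun s hs => ?_)
    exact ⟨le_max_right _ _, max_le (by linarith [hs.2]) ht.le⟩
  have hv0 : v 0 = 0 := by simp [hv]
  obtain ⟨z₁, hz₁, -⟩ := h (1 + t) (by linarith) v hvc hv0
  obtain ⟨z₂, hz₂, -⟩ := h 1 one_pos v (hvc.mono (Icc_subset_Icc_right (by linarith))) hv0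
  have key := S.T.duhamel_add_time zero_le_one ht.le (S.resB.continuous.comp_continuousOn hvc)
  refine ⟨z₁ - S.T t.toNNReal z₂, ?_⟩
  rw [map_sub, S.T.resolvent_comm S.β.2, hz₁, hz₂]
  refine sub_eq_of_eq_add' (key.trans (congrArg _ (S.T.duhamel_congr ht.le fun s hs => ?_)))
  simp [hv, hs.1]

theorem reaches_of_continuousOn {c : ℝ} (hc : 0 < c)
    (h : ∀ t : ℝ, 0 < t → ∀ u : ℝ → U, ContinuousOn u (Icc 0 t) → u 0 = 0 → S.Reaches c t u) :
    ∃ c' : ℝ, 0 < c' ∧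
      ∀ t : ℝ, 0 < t → ∀ u : ℝ → U, ContinuousOn u (Icc 0 t) → S.Reaches c' t u := by
  obtain ⟨M, hM1, hM⟩ := S.T.exists_norm_le_of_tendsto_resolvent S.β
  refine ⟨M * c, mul_pos (zero_lt_one.trans_le hM1) hc, fun t ht u hu => ?_⟩
  obtain ⟨z, hz⟩ := exists_resolvent_eq_duhamel h ht hu
  refine ⟨z, hz, fun K hK => ?_⟩
  -- These vanish at 0, never exceed `K`, and at each s > 0 eventually equal u(s).
  set v : ℕ → ℝ → U := fun n s => min (n * s) 1 • u s with hv
  have hvc : ∀ n, ContinuousOn (v n) (Icc 0 t) := fun n => by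
    have hmin : Continuous fun s : ℝ => min (n * s) 1 := by fun_prop
    exact hmin.continuousOn.smul hu
  have hvK : ∀ n, ∀ s ∈ Icc 0 t, ‖v n s‖ ≤ K := fun n s hs => by
    rw [hv, norm_smul, Real.norm_of_nonneg (le_min (mul_nonneg n.cast_nonneg hs.1) zero_le_one)]
    exact (mul_le_of_le_one_left (norm_nonneg _) (min_le_right _ _)).trans (hK s hs)
  choose x hx hxn using fun n => h t ht (v n) (hvc n) (by simp [hv])
  rw [mul_assoc]
  refine hM x z (c * K) ?_ fun n => hxn n K (hvK n)
  rw [hz, funext hx]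
  refine S.T.tendsto_duhamel (K := ‖S.resB‖ * K) ht.le
    (fun n => S.resB.continuous.comp_continuousOn (hvc n))
    (fun n s hs => (S.resB.le_opNorm _).trans
      (mul_le_mul_of_nonneg_left (hvK n s hs) (norm_nonneg _))) fun s hs => ?_
  refine tendsto_const_nhds.congr' ?_
  obtain ⟨N, hN⟩ := exists_nat_gt (1 / s)
  filter_upwards [eventually_ge_atTop N] with n hn
  have h1 : 1 ≤ (n : ℝ) * s := by
    rw [← div_le_iff₀ hs.1]
    exact hN.le.trans (by exact_mod_cast hn)
  simp only [hv, min_eq_right h1, one_smul]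

theorem OutputIsState.infiniteTimeCControlAdmissible (hS : S.OutputIsState)
    (h : S.IsSmoothBIBOStable) : S.T.InfiniteTimeCControlAdmissible S.β S.B := by
  obtain ⟨c, hc, h1⟩ := hS.exists_reaches_smooth h
  obtain ⟨c', hc', h2⟩ := reaches_of_continuousOn hc fun t ht u hu hu0 =>
    reaches_of_eq_zero h1 ht hu hu0
  refine S.admissible_iff.2 ⟨c', hc', fun t ht u hu => ?_⟩
  obtain ⟨z, hz, hzn⟩ := h2 t ht u hu
  exact ⟨z, hz, hzn _ fun s hs => le_ciSup (bddAbove_range_norm hu) ⟨s, hs⟩⟩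

end SystemNode

end

theorem mainTheorem9 {U X : Type*} [NormedAddCommGroup U] [NormedSpace ℂ U] [CompleteSpace U]
    [NormedAddCommGroup X] [NormedSpace ℂ X] [CompleteSpace X]
    (S : SystemNode U X X) (hS : S.OutputIsState) :
    S.IsSmoothBIBOStable ↔ S.T.InfiniteTimeCControlAdmissible S.β S.B :=
  ⟨hS.infiniteTimeCControlAdmissible, hS.isSmoothBIBOStable⟩
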